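/- Let $\mathbb F_q$ be a finite field with $q$ elements, let $K/\mathbb F_q$ be a function field in one variable, and fix a place $\mathfrak p_\infty$ of $K$ with normalized valuation $v_{\mathfrak p_\infty}$ and residue degree $d_\infty$ over $\mathbb F_q$. Let $A$ be the ring of all $x\in K$ with $v_{\mathfrak p}(x)\ge 0$ for every place $\mathfrak p\ne\mathfrak p_\infty$, and put $\deg a=-d_\infty v_{\mathfrak p_\infty}(a)$ for $a\in A\setminus\{0\}$. Fix an algebraic closure $\bar K$ of $K$, and let $K\subseteq E\subseteq L\subseteq\bar K$ be fields with $E/K$ and $L/E$ finite. Let $E\langle\tau\rangle$ be the ring of twisted polynomials over $E$, in which $\tau u=u^q\tau$ for $u\in E$; an element $f=\sum_i f_i\tau^i$ acts on $\bar K$ by $f(u)=\sum_i f_iu^{q^i}$. Let $\rho\colon A\to E\langle\tau\rangle$, $a\mapsto\rho_a$, be a Drinfeld $A$-module of rank one whose structural map is the natural embedding $A\hookrightarrow E$; that is, $\rho$ is a homomorphism of $\mathbb F_q$-algebras such that $\rho_a$ has constant coefficient $a$ for every $a\in A$, $\rho_a\neq a$ for some $a\in A$, and $\deg_\tau\rho_a=\deg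 a$ for every $a\in A\setminus\{0\}$. Let $$\mu_\rho(L)=\{u\in L\mid \rho_a(u)=0\text{ for some }a\in A\setminus\{0\}\},\qquad \rho[\mathfrak b]=\{u\in\bar K\mid\rho_c(u)=0\text{ for all }c\in\mathfrak b\}$$ for an ideal $\mathfrak b$ of $A$. Then there exists a nonzero ideal $\mathfrak b$ of $A$ such that $\mu_\rho(L)=\rho[\mathfrak b]$. In particular, let $k=\mathbb F_q(T)$, $R_T=\mathbb F_q[T]$, and let $\mathrm C\colon R_T\to k\langle\tau\rangle$ be the Carlitz module, i.e. the homomorphism of $\mathbb F_q$-algebras with $\mathrm C_T=T+\tau$. Then for every finite extension $L/k$ inside an algebraic closure $\bar k$ of $k$ there exists a nonzero $M\in R_T$ such that $$\mu_{\mathrm C}(L)=\{u\in L\mid \mathrm C_N(u)=0\text{ for some }N\in R_T\setminus\{0\}\}$$ is equal to $\Lambda_M=\{u\in\bar k\mid \mathrm C_M(u)=0\}$. -/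

import Mathlib

open scoped Polynomial RatFunc

noncomputable section

namespace Drinfeld

universe u v w x

/-! ### Twisted polynomials -/

section Twisted

/-- The ring `E⟨τ⟩` of twisted polynomials `∑ aᵢ τ ^ i` with coefficients in `E`, in which
`τ a = a ^ q τ` for `a ∈ E`, where `q = #F`. -/
@[nolint unusedArguments]
def TwistedPoly (_F : Type u) (E : Type v) [Field E] : Type v := SkewPolynomial E

variable (F : Type u) [Field F] [Fintype F] (E : Type v) [Field E] [Algebra F E]

/-- The action of `ℕ` on an `F`-algebra `E` by powers of the `q`-Frobenius `u ↦ u ^ q`,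
where `q = #F`: the number `n` acts as `u ↦ u ^ (q ^ n)`. -/
@[reducible]
def frobeniusAction : MulSemiringAction (Multiplicative ℕ) E where
  smul n u := ((FiniteField.frobeniusAlgHom F E) ^ (Multiplicative.toAdd n)) u
  one_smul _ := rfl
  mul_smul m n u := by
    change ((FiniteField.frobeniusAlgHom F E) ^
      (Multiplicative.toAdd m + Multiplicative.toAdd n)) u = _
    rw [pow_add]
    rfl
  smul_zero n := map_zero ((FiniteField.frobeniusAlgHom F E) ^ (Multiplicative.toAdd n))
  smul_add n := map_add ((FiniteField.frobeniusAlgHom F E) ^ (Multiplicative.toAdd n))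
  smul_one n := map_one ((FiniteField.frobeniusAlgHom F E) ^ (Multiplicative.toAdd n))
  smul_mul n := map_mul ((FiniteField.frobeniusAlgHom F E) ^ (Multiplicative.toAdd n))

instance : Ring (TwistedPoly F E) :=
  letI := frobeniusAction F E
  inferInstanceAs (Ring (SkewPolynomial E))

namespace TwistedPoly

/-- The constants `E → E⟨τ⟩`. -/
def C : E →+* TwistedPoly F E :=
  letI := frobeniusAction F E
  (SkewPolynomial.CRingHom : E →+* SkewPolynomial E)

/-- The variable `τ` of `E⟨τ⟩`. -/
def τ : TwistedPoly F E := (SkewPolynomial.X : SkewPolynomial E)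

variable {F E}

/-- The coefficient of `τ ^ i`. -/
def coeff (f : TwistedPoly F E) (i : ℕ) : E := SkewPolynomial.coeff (R := E) f i

/-- The (finite) set of exponents `i` such that the coefficient of `τ ^ i` is nonzero. -/
def support (f : TwistedPoly F E) : Finset ℕ := SkewPolynomial.support (R := E) f

/-- The degree in `τ` (with value `0` at the zero polynomial). -/
def degree (f : TwistedPoly F E) : ℕ := f.support.sup id

/-- The value `f(u) = ∑ aᵢ u ^ (q ^ i)` of `f = ∑ aᵢ τ ^ i` at an element `u` of a field
extension of `E`. -/
def eval {Ω : Type w} [Field Ω] [Algebra E Ω] (f : TwistedPoly F E) (u : Ω) : Ω :=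
  ∑ i ∈ f.support, algebraMap E Ω (f.coeff i) * u ^ (Fintype.card F ^ i)

variable (F E) in
/-- The relation `τ a = a ^ q τ`. -/
theorem τ_mul_C (a : E) : τ F E * C F E a = C F E (a ^ Fintype.card F) * τ F E := by
  let _ := frobeniusAction F E
  have h : (SkewPolynomial.X * SkewPolynomial.C a : SkewPolynomial E)
      = SkewPolynomial.C (a ^ Fintype.card F) * SkewPolynomial.X := by
    rw [← SkewPolynomial.monomial_one_one_eq_X, SkewPolynomial.monomial_mul_C,
      SkewPolynomial.C_mul_monomial, one_mul, mul_one]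
    rfl
  exact h

end TwistedPoly

end Twisted

/-! ### Torsion -/

section Torsion

variable {F : Type u} [Field F] [Fintype F] {E : Type v} [Field E] [Algebra F E]
  {R : Type w} [CommRing R] {Ω : Type x} [Field Ω] [Algebra E Ω]

/-- For `ρ : R → E⟨τ⟩` and a field `L` with `E ⊆ L ⊆ Ω`, the torsion
`μ_ρ(L) = {u ∈ L | ρ_a(u) = 0 for some a ∈ R, a ≠ 0}`. -/
def torsion (ρ : R →+* TwistedPoly F E) (L : IntermediateField E Ω) : Set Ω :=
  {u | u ∈ L ∧ ∃ a : R, a ≠ 0 ∧ (ρ a).eval u = 0}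

variable (Ω) in
/-- For `ρ : R → E⟨τ⟩` and an ideal `I` of `R`, the set
`ρ[I] = {u ∈ Ω | ρ_c(u) = 0 for all c ∈ I}`. -/
def idealTorsion (ρ : R →+* TwistedPoly F E) (I : Ideal R) : Set Ω :=
  {u | ∀ c ∈ I, (ρ c).eval u = 0}

end Torsion

/-! ### Places and the ring of functions regular outside one place -/

section Place

variable (F : Type u) [Field F] (K : Type v) [Field K] [Algebra F K]

/-- A place (prime divisor) of the function field `K / F`, given by its valuation ring: a
discrete valuation ring of `K` containing the constants `F`. -/
structure Place where
  /-- the valuation ring of the place -/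
  ring : ValuationSubring K
  algebraMap_mem : ∀ c : F, algebraMap F K c ∈ ring
  isDVR : IsDiscreteValuationRing ring

namespace Place

variable {F K} (P : Place F K)

instance : IsDiscreteValuationRing P.ring := P.isDVR

instance : Algebra F P.ring :=
  ((algebraMap F K).codRestrict P.ring P.algebraMap_mem).toAlgebra

/-- The residue degree of the place `P`: the dimension over `F` of its residue field. -/
def residueDegree : ℕ := Module.finrank F (IsLocalRing.ResidueField P.ring)

/-- The order `v_P(a)` of `a ∈ K` at `P`, normalized so that a uniformizer has order `1`
(with value `0` at `a = 0`). -/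
def ord (a : K) : ℤ :=
  -WithZero.log ((IsDiscreteValuationRing.maximalIdeal P.ring).valuation K a)

/-- The ring `A` of all elements of `K` that are regular at every place different from `P`. -/
def affineRing : Subalgebra F K where
  carrier := {a | ∀ Q : Place F K, Q ≠ P → a ∈ Q.ring}
  mul_mem' ha hb Q hQ := mul_mem (ha Q hQ) (hb Q hQ)
  add_mem' ha hb Q hQ := add_mem (ha Q hQ) (hb Q hQ)
  algebraMap_mem' c Q _ := Q.algebraMap_mem c

/-- The degree `deg a = - d_P v_P(a)`, for nonzero `a`, where `d_P` is the residue degree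
of `P`. -/
def deg (a : K) : ℤ := -(P.residueDegree * P.ord a)

end Place

end Place

/-! ### Drinfeld modules -/

section DrinfeldModule

variable {F : Type u} [Field F] [Fintype F] {K : Type v} [Field K] [Algebra F K]

/-- A Drinfeld `A`-module over an extension field `E` of `K`, where `A` is the ring of functions
of `K` regular outside the place `P` and the structural map `A → E` is the natural embedding:
a homomorphism of `F`-algebras `ρ : A → E⟨τ⟩`, `a ↦ ρ_a`, such that `ρ_a` has constant
coefficient `a` for all `a`, and `ρ_a ≠ a` for some `a`. -/
structure DrinfeldModule (P : Place F K) (E : Type w) [Field E] [Algebra F E] [Algebra K E] where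
  /-- the homomorphism `a ↦ ρ_a` -/
  hom : P.affineRing →+* TwistedPoly F E
  hom_algebraMap : ∀ c : F,
    hom (algebraMap F P.affineRing c) = TwistedPoly.C F E (algebraMap F E c)
  coeff_zero : ∀ a : P.affineRing, (hom a).coeff 0 = algebraMap K E (a : K)
  nontrivial : ∃ a : P.affineRing, hom a ≠ TwistedPoly.C F E (algebraMap K E (a : K))

/-- The Drinfeld module `ρ` has rank `r` if `deg_τ ρ_a = r * deg a` for all nonzero `a ∈ A`. -/
def DrinfeldModule.HasRank {P : Place F K} {E : Type w} [Field E] [Algebra F E] [Algebra K E]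
    (ρ : DrinfeldModule P E) (r : ℕ) : Prop :=
  ∀ a : P.affineRing, a ≠ 0 → ((ρ.hom a).degree : ℤ) = r * P.deg (a : K)

end DrinfeldModule

/-! ### The Carlitz module -/

section Carlitz

variable (F : Type u) [Field F] [Fintype F]

/-- The Carlitz module `F[T] → F(T)⟨τ⟩`: the homomorphism of `F`-algebras sending `T` to
`T + τ`. -/
def carlitz : F[X] →+* TwistedPoly F F⟮X⟯ :=
  Polynomial.eval₂RingHom'
    ((TwistedPoly.C F F⟮X⟯).comp (algebraMap F F⟮X⟯))
    (TwistedPoly.C F F⟮X⟯ RatFunc.X + TwistedPoly.τ F F⟮X⟯) (fun c => by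
      apply Commute.add_right
      · exact (Commute.all (algebraMap F F⟮X⟯ c) RatFunc.X).map (TwistedPoly.C F F⟮X⟯)
      · change _ * _ = _ * _
        rw [RingHom.comp_apply, TwistedPoly.τ_mul_C, ← map_pow, FiniteField.pow_card])

/-- The set `Λ_M = {u ∈ Ω | C_M(u) = 0}` of `M`-torsion points of the Carlitz module. -/
def carlitzTorsion (Ω : Type v) [Field Ω] [Algebra F⟮X⟯ Ω] (M : F[X]) : Set Ω :=
  {u | (carlitz F M).eval u = 0}

end Carlitz

end Drinfeld

end

noncomputable section

set_option linter.unusedSectionVars false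

/-! Two facts give the theorem: `μ_ρ(L)` is finite, and every finite `A`-submodule of the torsion is
an ideal torsion.

Finiteness is a Northcott argument. A torsion point is preperiodic under `ρ_{a₀}` for any `a₀` with
`deg_τ ρ_{a₀} > 0`, because its orbit stays in the finite kernel of a single `ρ_a`. Preperiodic
points have a common denominator over `F[X]` and over the valuation ring of `F(X)` at infinity
(`exists_smul_isIntegral_of_finite_orbit`). The coefficients of their minimal polynomials of bounded
degree therefore lie in a finite set (`finite_preperiodic`).

For the second fact, choose `c ≠ 0` in `A` killing `μ_ρ(L)`. The kernel of `ρ_c` has at most `q ^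
deg c` elements, `A / c` has at least that many, and only multiples of `c` kill this kernel. Over a
Dedekind domain this makes the kernel cyclic and isomorphic to `A / c`, so each of its submodules is
cut out by an ideal dividing `(c)` (`exists_forall_mem_iff_smul_eq_zero`).

The properties of `A` come from rank one without Riemann–Roch. Since `deg_τ ρ_a ≥ 0`, no nonzero `a
∈ A` vanishes at `P`. Counting `A` by pole order at `P` then bounds `A / c`, and shows that any
larger ring with this property is integral over `A`, hence equal to `A`. Applied to the quotients `a
/ c` for which `ρ_c` divides `ρ_a` on the right, this shows that right divisibility of `ρ_a` by
`ρ_c` forces `c ∣ a`. For the Carlitz module, division with remainder does the same work. -/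

namespace Drinfeld

/-! ### Arithmetic of twisted polynomials: coefficients, degree, right division. -/

namespace TwistedPoly

universe u v w

variable {F : Type u} [Field F] [Fintype F] {E : Type v} [Field E] [Algebra F E]

variable (F) in
/-- The monomial `a τ ^ n`. -/
def monomial (n : ℕ) (a : E) : TwistedPoly F E := SkewPolynomial.monomial (R := E) n a

@[ext]
theorem ext {f g : TwistedPoly F E} (h : ∀ n, f.coeff n = g.coeff n) : f = g :=
  SkewPolynomial.ext (R := E) h

theorem coeff_add (f g : TwistedPoly F E) (n : ℕ) : (f + g).coeff n = f.coeff n + g.coeff n :=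
  SkewPolynomial.coeff_add (R := E) f g n

@[simp]
theorem coeff_zero (n : ℕ) : (0 : TwistedPoly F E).coeff n = 0 := rfl

theorem coeff_sub (f g : TwistedPoly F E) (n : ℕ) : (f - g).coeff n = f.coeff n - g.coeff n :=
  eq_sub_of_add_eq (by rw [← coeff_add, sub_add_cancel])

theorem coeff_monomial (n m : ℕ) (a : E) :
    (monomial F n a).coeff m = if n = m then a else 0 :=
  SkewPolynomial.coeff_monomial (R := E)

theorem mem_support {f : TwistedPoly F E} {n : ℕ} : n ∈ f.support ↔ f.coeff n ≠ 0 :=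
  SkewPolynomial.mem_support_iff (R := E)

theorem monomial_zero_eq_C (a : E) : monomial F 0 a = C F E a := rfl

theorem monomial_one_one_eq_τ : monomial F 1 (1 : E) = τ F E := rfl

theorem one_eq_monomial : (1 : TwistedPoly F E) = monomial F 0 1 := rfl

theorem induction {motive : TwistedPoly F E → Prop} (f : TwistedPoly F E) (h0 : motive 0)
    (hadd : ∀ n a g, motive g → motive (monomial F n a + g)) : motive f :=
  SkewPolynomial.induction (R := E) f h0 fun n r q _ _ hq => hadd n r q hq

theorem frobenius_pow_apply (n : ℕ) (a : E) :
    ((FiniteField.frobeniusAlgHom F E) ^ n) a = a ^ (Fintype.card F ^ n) := by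
  induction n generalizing a with
  | zero => simp
  | succ n ih =>
    rw [pow_succ, AlgHom.mul_apply, ih, FiniteField.coe_frobeniusAlgHom, ← pow_mul, pow_succ']

theorem add_pow_card_pow {R : Type*} [CommRing R] [Algebra F R] (n : ℕ) (a b : R) :
    (a + b) ^ (Fintype.card F ^ n) = a ^ (Fintype.card F ^ n) + b ^ (Fintype.card F ^ n) := by
  induction n with
  | zero => simp
  | succ n ih =>
    rw [pow_succ, pow_mul, ih, pow_mul, pow_mul]
    exact map_add (FiniteField.frobeniusAlgHom F R) _ _

theorem card_pow_ne_zero (F : Type*) [Fintype F] [Nonempty F] (n : ℕ) :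
    Fintype.card F ^ n ≠ 0 := pow_ne_zero _ Fintype.card_ne_zero

theorem monomial_mul_monomial (n m : ℕ) (a b : E) :
    monomial F n a * monomial F m b = monomial F (n + m) (a * b ^ (Fintype.card F ^ n)) := by
  let _ := frobeniusAction F E
  refine (SkewPolynomial.monomial_mul_monomial (R := E) n m a b).trans ?_
  rw [SkewPolynomial.φ_iterate_apply, ← frobenius_pow_apply]
  rfl

theorem coeff_mul (f g : TwistedPoly F E) (k : ℕ) :
    (f * g).coeff k = ∑ p ∈ Finset.HasAntidiagonal.antidiagonal k,
      f.coeff p.1 * g.coeff p.2 ^ (Fintype.card F ^ p.1) := by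
  induction f using induction with
  | h0 => simp
  | hadd n a f ih =>
    rw [add_mul, coeff_add, ih]
    simp only [coeff_add, add_mul, Finset.sum_add_distrib]
    congr 1
    clear ih
    induction g using induction with
    | h0 => simp
    | hadd m b g ih =>
      rw [mul_add, coeff_add, ih]
      simp only [coeff_add, add_pow_card_pow, mul_add, Finset.sum_add_distrib]
      congr 1
      rw [monomial_mul_monomial, coeff_monomial]
      simp only [coeff_monomial]
      split_ifs with h
      · subst h
        rw [Finset.sum_eq_single (n, m)]
        · simp
        · rintro ⟨i, j⟩ _ hij
          by_cases h1 : n = i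
          · have : m ≠ j := by rintro rfl; exact hij (by rw [h1])
            simp [this]
          · simp [h1]
        · simp
      · refine (Finset.sum_eq_zero ?_).symm
        rintro ⟨i, j⟩ hij
        rw [Finset.HasAntidiagonal.mem_antidiagonal] at hij
        by_cases h1 : n = i
        · have : m ≠ j := by rintro rfl; exact h (by rw [h1]; exact hij)
          simp [this]
        · simp [h1]

theorem le_degree {f : TwistedPoly F E} {n : ℕ} (h : f.coeff n ≠ 0) : n ≤ f.degree :=
  Finset.le_sup (f := id) (mem_support.2 h)

theorem coeff_eq_zero_of_degree_lt {f : TwistedPoly F E} {n : ℕ} (h : f.degree < n) :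
    f.coeff n = 0 := by
  by_contra hn
  exact absurd (le_degree hn) (not_le.2 h)

theorem degree_le {f : TwistedPoly F E} {n : ℕ} (h : ∀ k, n < k → f.coeff k = 0) :
    f.degree ≤ n :=
  Finset.sup_le fun k hk => not_lt.1 fun hnk => mem_support.1 hk (h k hnk)

theorem coeff_degree_ne_zero {f : TwistedPoly F E} (hf : f ≠ 0) : f.coeff f.degree ≠ 0 := by
  have hne : f.support.Nonempty := by
    by_contra h
    rw [Finset.not_nonempty_iff_eq_empty] at h
    refine hf (ext fun n => ?_)
    by_contra hn
    exact absurd (h ▸ mem_support.2 hn) (Finset.notMem_empty n)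
  obtain ⟨k, hk, hk'⟩ := Finset.exists_mem_eq_sup _ hne id
  have : f.degree = k := hk'
  rw [this]
  exact mem_support.1 hk

theorem coeff_mul_degree (f g : TwistedPoly F E) :
    (f * g).coeff (f.degree + g.degree) =
      f.coeff f.degree * g.coeff g.degree ^ (Fintype.card F ^ f.degree) := by
  rw [coeff_mul, Finset.sum_eq_single (f.degree, g.degree)]
  · rintro ⟨i, j⟩ hij hne
    rw [Finset.HasAntidiagonal.mem_antidiagonal] at hij
    dsimp only at hij ⊢
    rcases lt_trichotomy i f.degree with h | h | h
    · rw [coeff_eq_zero_of_degree_lt (f := g) (by omega), zero_pow (card_pow_ne_zero F _),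
        mul_zero]
    · exact absurd (Prod.ext h (by dsimp only; omega)) hne
    · rw [coeff_eq_zero_of_degree_lt h, zero_mul]
  · simp

theorem coeff_mul_degree_ne_zero {f g : TwistedPoly F E} (hf : f ≠ 0) (hg : g ≠ 0) :
    (f * g).coeff (f.degree + g.degree) ≠ 0 := by
  rw [coeff_mul_degree]
  exact mul_ne_zero (coeff_degree_ne_zero hf) (pow_ne_zero _ (coeff_degree_ne_zero hg))

theorem mul_ne_zero' {f g : TwistedPoly F E} (hf : f ≠ 0) (hg : g ≠ 0) : f * g ≠ 0 :=
  fun h => coeff_mul_degree_ne_zero hf hg (by rw [h, coeff_zero])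

theorem degree_mul {f g : TwistedPoly F E} (hf : f ≠ 0) (hg : g ≠ 0) :
    (f * g).degree = f.degree + g.degree := by
  refine le_antisymm (degree_le fun k hk => ?_) (le_degree (coeff_mul_degree_ne_zero hf hg))
  rw [coeff_mul]
  refine Finset.sum_eq_zero ?_
  rintro ⟨i, j⟩ hij
  rw [Finset.HasAntidiagonal.mem_antidiagonal] at hij
  dsimp only at hij ⊢
  by_cases h : f.degree < i
  · rw [coeff_eq_zero_of_degree_lt h, zero_mul]
  · rw [coeff_eq_zero_of_degree_lt (f := g) (by omega), zero_pow (card_pow_ne_zero F _),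
      mul_zero]

theorem degree_monomial {n : ℕ} {a : E} (ha : a ≠ 0) : (monomial F n a).degree = n := by
  refine le_antisymm (degree_le fun k hk => ?_) (le_degree ?_)
  · rw [coeff_monomial, if_neg hk.ne]
  · rwa [coeff_monomial, if_pos rfl]

/-- Right division with remainder. -/
theorem exists_right_division (f : TwistedPoly F E) {h : TwistedPoly F E} (hh : h ≠ 0) :
    ∃ g r : TwistedPoly F E, f = g * h + r ∧ ∀ k, h.degree ≤ k → r.coeff k = 0 := by
  suffices H : ∀ (n : ℕ) (f : TwistedPoly F E), (∀ k, n ≤ k → f.coeff k = 0) →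
      ∃ g r : TwistedPoly F E, f = g * h + r ∧ ∀ k, h.degree ≤ k → r.coeff k = 0 from
    H (f.degree + 1) f fun k hk => coeff_eq_zero_of_degree_lt hk
  intro n
  induction n with
  | zero => exact fun f hf => ⟨0, f, by simp, fun k _ => hf k (Nat.zero_le k)⟩
  | succ n ih =>
    intro f hf
    by_cases hn : n < h.degree
    · exact ⟨0, f, by simp, fun k hk => hf k (by omega)⟩
    obtain ⟨m, rfl⟩ := Nat.exists_eq_add_of_le' (not_lt.1 hn)
    -- Moving `τ ^ m` past the leading coefficient of `h` raises that coefficient to the power `q ^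
    -- m`, so this `c` cancels the top term of `f`.
    set c := f.coeff (m + h.degree) / h.coeff h.degree ^ (Fintype.card F ^ m) with hc
    have key : ∀ k, m + h.degree ≤ k → (f - monomial F m c * h).coeff k = 0 := by
      intro k hk
      rw [coeff_sub, coeff_mul]
      rcases hk.eq_or_lt with rfl | hk
      · rw [Finset.sum_eq_single (m, h.degree)]
        · simp only [coeff_monomial, if_true, hc]
          rw [div_mul_cancel₀ _ (pow_ne_zero _ (coeff_degree_ne_zero hh)), sub_self]
        · rintro ⟨i, j⟩ hij hne
          rw [Finset.HasAntidiagonal.mem_antidiagonal] at hij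
          dsimp only at hij ⊢
          have : m ≠ i := by
            rintro rfl
            exact hne (Prod.ext rfl (by dsimp only; omega))
          rw [coeff_monomial, if_neg this, zero_mul]
        · simp
      · rw [hf k (by omega), zero_sub, neg_eq_zero]
        refine Finset.sum_eq_zero ?_
        rintro ⟨i, j⟩ hij
        rw [Finset.HasAntidiagonal.mem_antidiagonal] at hij
        dsimp only at hij ⊢
        by_cases hi : m = i
        · rw [coeff_eq_zero_of_degree_lt (f := h) (by omega), zero_pow (card_pow_ne_zero F _),
            mul_zero]
        · rw [coeff_monomial, if_neg hi, zero_mul]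
    obtain ⟨g, r, hgr, hr⟩ := ih _ key
    refine ⟨monomial F m c + g, r, ?_, hr⟩
    rw [add_mul, add_assoc, ← hgr, add_sub_cancel]

/-! ### Twisted polynomials as additive maps, and the size of their kernels. -/

section Eval

variable {Ω : Type w} [Field Ω] [Algebra E Ω]

theorem eval_eq_sum_of_subset (f : TwistedPoly F E) {s : Finset ℕ} (hs : f.support ⊆ s) (u : Ω) :
    f.eval u = ∑ i ∈ s, algebraMap E Ω (f.coeff i) * u ^ (Fintype.card F ^ i) :=
  Finset.sum_subset hs fun i _ hi => by
    rw [not_not.1 (mt mem_support.2 hi), map_zero, zero_mul]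

@[simp]
theorem zero_eval (u : Ω) : (0 : TwistedPoly F E).eval u = 0 := rfl

theorem add_eval (f g : TwistedPoly F E) (u : Ω) : (f + g).eval u = f.eval u + g.eval u := by
  classical
  rw [eval_eq_sum_of_subset f (s := f.support ∪ g.support ∪ (f + g).support)
      (fun i hi => by simp [hi]),
    eval_eq_sum_of_subset g (s := f.support ∪ g.support ∪ (f + g).support)
      (fun i hi => by simp [hi]),
    eval_eq_sum_of_subset (f + g) (s := f.support ∪ g.support ∪ (f + g).support)
      (fun i hi => by simp [hi]), ← Finset.sum_add_distrib]
  simp only [coeff_add, map_add, add_mul]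

theorem monomial_eval (n : ℕ) (a : E) (u : Ω) :
    (monomial F n a).eval u = algebraMap E Ω a * u ^ (Fintype.card F ^ n) := by
  rw [eval_eq_sum_of_subset _ (s := {n})]
  · simp [coeff_monomial]
  · intro i hi
    rw [mem_support, coeff_monomial] at hi
    by_contra h
    exact hi (if_neg fun h' => h (by simp [h']))

theorem eval_add (f : TwistedPoly F E) (u v : Ω) : f.eval (u + v) = f.eval u + f.eval v := by
  let _ : Algebra F Ω := ((algebraMap E Ω).comp (algebraMap F E)).toAlgebra
  simp only [eval, add_pow_card_pow, mul_add, Finset.sum_add_distrib]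

@[simp]
theorem eval_zero (f : TwistedPoly F E) : f.eval (0 : Ω) = 0 := by
  simp [eval]

theorem mul_eval (f g : TwistedPoly F E) (u : Ω) : (f * g).eval u = f.eval (g.eval u) := by
  induction f using induction with
  | h0 => simp
  | hadd n a f ih =>
    rw [add_mul, add_eval, add_eval, ih]
    congr 1
    clear ih
    induction g using induction with
    | h0 => simp
    | hadd m b g ih =>
      rw [mul_add, add_eval, add_eval, ih, eval_add]
      congr 1
      simp only [monomial_mul_monomial, monomial_eval, map_mul, map_pow]
      rw [mul_pow, ← pow_mul, ← pow_add, mul_assoc, add_comm n m, pow_add]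

theorem one_eval (u : Ω) : (1 : TwistedPoly F E).eval u = u := by
  rw [one_eq_monomial, monomial_eval]
  simp

variable (F E Ω) in
/-- The action of twisted polynomials on an extension field, as a ring homomorphism. -/
def evalHom : TwistedPoly F E →+* AddMonoid.End Ω where
  toFun f :=
    { toFun := f.eval
      map_zero' := eval_zero f
      map_add' := eval_add f }
  map_one' := AddMonoidHom.ext fun u => one_eval (F := F) (E := E) u
  map_mul' f g := AddMonoidHom.ext (mul_eval f g)
  map_zero' := AddMonoidHom.ext fun u => zero_eval (F := F) (E := E) u
  map_add' f g := AddMonoidHom.ext (add_eval f g)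

variable (Ω) in
/-- The additive polynomial `∑ aᵢ X ^ (q ^ i)` attached to `∑ aᵢ τ ^ i`. -/
def toPolynomial (f : TwistedPoly F E) : Polynomial Ω :=
  ∑ i ∈ f.support, Polynomial.C (algebraMap E Ω (f.coeff i)) * Polynomial.X ^ (Fintype.card F ^ i)

theorem toPolynomial_eval (f : TwistedPoly F E) (u : Ω) :
    (f.toPolynomial Ω).eval u = f.eval u := by
  simp [toPolynomial, eval, Polynomial.eval_finsetSum]

theorem toPolynomial_coeff (f : TwistedPoly F E) (k : ℕ) :
    (f.toPolynomial Ω).coeff (Fintype.card F ^ k) = algebraMap E Ω (f.coeff k) := by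
  have hinj := Nat.pow_right_injective (Fintype.one_lt_card (α := F))
  simp only [toPolynomial, Polynomial.finsetSum_coeff, Polynomial.coeff_C_mul,
    Polynomial.coeff_X_pow, hinj.eq_iff, mul_ite, mul_one, mul_zero, Finset.sum_ite_eq]
  split_ifs with h
  · rfl
  · rw [not_not.1 (mt mem_support.2 h), map_zero]

theorem toPolynomial_ne_zero {f : TwistedPoly F E} (hf : f ≠ 0) : f.toPolynomial Ω ≠ 0 := by
  intro h
  have := toPolynomial_coeff (Ω := Ω) f f.degree
  rw [h, Polynomial.coeff_zero] at this
  exact coeff_degree_ne_zero hf ((map_eq_zero _).1 this.symm)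

theorem toPolynomial_natDegree_le {f : TwistedPoly F E} {n : ℕ}
    (h : ∀ k, n < k → f.coeff k = 0) : (f.toPolynomial Ω).natDegree ≤ Fintype.card F ^ n := by
  refine Polynomial.natDegree_sum_le_of_forall_le _ _ fun i hi => ?_
  refine (Polynomial.natDegree_C_mul_X_pow_le _ _).trans
    (Nat.pow_le_pow_right Fintype.card_pos (not_lt.1 fun hn => mem_support.1 hi (h i hn)))

theorem toPolynomial_natDegree {f : TwistedPoly F E} (hf : f ≠ 0) :
    (f.toPolynomial Ω).natDegree = Fintype.card F ^ f.degree := by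
  refine le_antisymm (toPolynomial_natDegree_le fun k => coeff_eq_zero_of_degree_lt)
    (Polynomial.le_natDegree_of_ne_zero ?_)
  rw [toPolynomial_coeff]
  exact (map_ne_zero _).2 (coeff_degree_ne_zero hf)

theorem rootSet_toPolynomial {f : TwistedPoly F E} (hf : f ≠ 0) :
    (f.toPolynomial Ω).rootSet Ω = {u : Ω | f.eval u = 0} := by
  ext u
  rw [Polynomial.mem_rootSet_of_ne (toPolynomial_ne_zero hf), Polynomial.coe_aeval_eq_eval,
    toPolynomial_eval, Set.mem_ofPred_eq]

theorem finite_kernel {f : TwistedPoly F E} (hf : f ≠ 0) : {u : Ω | f.eval u = 0}.Finite := by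
  rw [← rootSet_toPolynomial hf]
  exact Polynomial.rootSet_finite _ _

theorem ncard_kernel_le {f : TwistedPoly F E} (hf : f ≠ 0) :
    {u : Ω | f.eval u = 0}.ncard ≤ Fintype.card F ^ f.degree := by
  rw [← rootSet_toPolynomial hf, ← toPolynomial_natDegree (Ω := Ω) hf]
  exact Polynomial.ncard_rootSet_le _ _

/-- A nonzero `r` of degree below `n` has fewer than `q ^ n` zeros. This is what kills the remainder
of a right division. -/
theorem eq_zero_of_kernel_large {r : TwistedPoly F E} {n : ℕ} (hr : ∀ k, n ≤ k → r.coeff k = 0)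
    {S : Set Ω} (hS : ∀ u ∈ S, r.eval u = 0) (hcard : Fintype.card F ^ n ≤ S.ncard) : r = 0 := by
  by_contra hne
  have hn : r.degree < n := by
    by_contra h
    exact coeff_degree_ne_zero hne (hr _ (not_lt.1 h))
  have h1 := Set.ncard_le_ncard (s := S) (t := {u : Ω | r.eval u = 0}) hS (finite_kernel hne)
  have h2 := ncard_kernel_le (Ω := Ω) hne
  have h3 := Nat.pow_lt_pow_right (Fintype.one_lt_card (α := F)) hn
  omega

/-- In characteristic dividing `q`, the derivative of an additive polynomial is its constant
coefficient; when this is nonzero the polynomial is separable and all its roots are distinct. -/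
theorem ncard_kernel [IsAlgClosed Ω] {f : TwistedPoly F E} (hf : f.coeff 0 ≠ 0) :
    {u : Ω | f.eval u = 0}.ncard = Fintype.card F ^ f.degree := by
  have hne : f ≠ 0 := by rintro rfl; exact hf rfl
  let _ : Algebra F Ω := ((algebraMap E Ω).comp (algebraMap F E)).toAlgebra
  have hq : (Fintype.card F : Ω) = 0 := by
    rw [← map_natCast (algebraMap F Ω), FiniteField.cast_card_eq_zero, map_zero]
  have hd : Polynomial.derivative (f.toPolynomial Ω) =
      Polynomial.C (algebraMap E Ω (f.coeff 0)) := by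
    rw [toPolynomial, Polynomial.derivative_sum, Finset.sum_eq_single 0]
    · simp
    · intro i _ hi
      rw [Polynomial.derivative_C_mul_X_pow, Nat.cast_pow, hq, zero_pow hi, mul_zero,
        map_zero, zero_mul]
    · intro h
      exact absurd (mem_support.2 hf) h
  have hsep : (f.toPolynomial Ω).Separable := by
    rw [Polynomial.separable_def, hd]
    refine ⟨0, Polynomial.C (algebraMap E Ω (f.coeff 0))⁻¹, ?_⟩
    rw [zero_mul, zero_add, ← Polynomial.C_mul, inv_mul_cancel₀ ((map_ne_zero _).2 hf),
      Polynomial.C_1]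
  rw [← rootSet_toPolynomial hne, ← toPolynomial_natDegree (Ω := Ω) hne,
    ← Nat.card_coe_set_eq, Nat.card_eq_fintype_card]
  exact Polynomial.card_rootSet_eq_natDegree hsep (IsAlgClosed.splits _)

/-- A twisted polynomial vanishing on the kernel of a separable one is a left multiple of it. -/
theorem exists_eq_mul_of_kernel_le [IsAlgClosed Ω] {f h : TwistedPoly F E} (hh : h.coeff 0 ≠ 0)
    (hf : ∀ u : Ω, h.eval u = 0 → f.eval u = 0) : ∃ g, f = g * h := by
  have hne : h ≠ 0 := by rintro rfl; exact hh rfl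
  obtain ⟨g, r, hgr, hr⟩ := exists_right_division f hne
  refine ⟨g, ?_⟩
  have : r = 0 := by
    refine eq_zero_of_kernel_large hr (S := {u : Ω | h.eval u = 0}) (fun u hu => ?_)
      (ncard_kernel hh).ge
    have := hf u hu
    rwa [hgr, add_eval, mul_eval, show h.eval u = 0 from hu, eval_zero, zero_add] at this
  rw [hgr, this, add_zero]

theorem eval_mem {f : TwistedPoly F E} {L : IntermediateField E Ω} {u : Ω} (hu : u ∈ L) :
    f.eval u ∈ L :=
  sum_mem fun _ _ => mul_mem (L.algebraMap_mem _) (pow_mem hu _)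

end Eval

end TwistedPoly

/-! ### Finiteness of preperiodic points of bounded degree over `F(X)`. -/

section Northcott

open Polynomial

/-- Where the coefficients of `f` divided by the leading coefficient are at most `|r|⁻¹`, the
polynomial map `f` expands the region `1 < |r w|`. -/
theorem valuation_lt_valuation_eval {Ω : Type*} [Field Ω] (V : ValuationSubring Ω) {f : Polynomial Ω}
    (hf : 2 ≤ f.natDegree) {r : Ω} (hr : r ∈ V) (hr0 : r ≠ 0)
    (hcoeff : ∀ i, r * (f.coeff i / f.leadingCoeff) ∈ V) (hlead : r * f.leadingCoeff⁻¹ ∈ V)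
    {w : Ω} (hw : 1 < V.valuation (r * w)) :
    V.valuation w < V.valuation (f.eval w) := by
  set v := V.valuation with hv
  have hl0 : f.leadingCoeff ≠ 0 := by
    rw [Polynomial.leadingCoeff_ne_zero]
    rintro rfl
    simp at hf
  have hvr0 : 0 < v r := zero_lt_iff.2 ((v.ne_zero_iff).2 hr0)
  have hvr1 : v r ≤ 1 := (V.valuation_le_one_iff r).2 hr
  have hvl0 : 0 < v f.leadingCoeff := zero_lt_iff.2 ((v.ne_zero_iff).2 hl0)
  -- Used three times: for the coefficient quotients it makes the leading term of `f w` dominate,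
  -- for `1` it gives `1 < |w|`, and for the inverse leading coefficient `l⁻¹` it gives `1 < |l w|`.
  have hsmall : ∀ x : Ω, r * x ∈ V → v x < v w := by
    intro x hx
    have h1 : v (r * x) < v (r * w) := lt_of_le_of_lt ((V.valuation_le_one_iff _).2 hx) hw
    rw [map_mul, map_mul] at h1
    exact lt_of_mul_lt_mul_left h1 hvr0.le
  have hw1 : 1 < v w := by simpa using hsmall 1 (by simpa using hr)
  have hw0 : 0 < v w := zero_lt_one.trans hw1
  obtain ⟨N, hN⟩ : ∃ N, f.natDegree = N + 1 + 1 := ⟨f.natDegree - 2, by omega⟩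
  have hterm : ∀ i ∈ Finset.range (N + 1 + 1),
      v (f.coeff i * w ^ i) < v (f.leadingCoeff * w ^ (N + 1 + 1)) := by
    intro i hi
    have hi' : i + 1 ≤ N + 1 + 1 := by simpa using hi
    have h1 : v (f.coeff i / f.leadingCoeff) * v w ^ i < v w ^ (N + 1 + 1) :=
      calc v (f.coeff i / f.leadingCoeff) * v w ^ i < v w * v w ^ i :=
            mul_lt_mul_of_pos_right (hsmall _ (hcoeff i)) (pow_pos hw0 i)
        _ = v w ^ (i + 1) := (pow_succ' _ _).symm
        _ ≤ v w ^ (N + 1 + 1) := pow_le_pow_right₀ hw1.le hi'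
    have h2 := mul_lt_mul_of_pos_left h1 hvl0
    rwa [← mul_assoc, ← map_mul, mul_div_cancel₀ _ hl0, ← map_pow, ← map_mul, ← map_pow,
      ← map_mul] at h2
  have hev : v (f.eval w) = v (f.leadingCoeff * w ^ (N + 1 + 1)) := by
    rw [Polynomial.eval_eq_sum_range, hN, Finset.sum_range_succ,
      show f.coeff (N + 1 + 1) = f.leadingCoeff by rw [Polynomial.leadingCoeff, hN]]
    refine v.map_add_eq_of_lt_right (v.map_sum_lt ?_ hterm)
    exact (v.ne_zero_iff).2 (mul_ne_zero hl0 (pow_ne_zero _ ((v.ne_zero_iff).1 hw0.ne')))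
  have hl : 1 < v f.leadingCoeff * v w := by
    have := mul_lt_mul_of_pos_left (hsmall _ hlead) hvl0
    rwa [← map_mul, mul_inv_cancel₀ hl0, map_one] at this
  calc v w = 1 * v w := (one_mul _).symm
    _ < v f.leadingCoeff * v w * v w := mul_lt_mul_of_pos_right hl hw0
    _ ≤ v f.leadingCoeff * v w * v w ^ (N + 1) := by
        gcongr
        exact le_self_pow₀ hw1.le (Nat.succ_ne_zero N)
    _ = v (f.eval w) := by rw [hev, map_mul, map_pow, mul_assoc, ← pow_succ']

/-- Preperiodic points of a polynomial of degree at least two have a common denominator. -/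
theorem exists_smul_isIntegral_of_finite_orbit {R Ω : Type*} [CommRing R] [IsDomain R] [Field Ω]
    [Algebra R Ω] [Algebra.IsAlgebraic R Ω] [FaithfulSMul R Ω] {f : Polynomial Ω}
    (hf : 2 ≤ f.natDegree) :
    ∃ r : R, r ≠ 0 ∧ ∀ u : Ω, (Set.range fun n => (fun w => f.eval w)^[n] u).Finite →
      IsIntegral R (r • u) := by
  classical
  -- The common denominator depends only on `f`: it clears the coefficients divided by the leading
  -- one, and the inverse of the leading one.
  obtain ⟨r, hr0, hr⟩ := Algebra.IsAlgebraic.exists_integral_multiples R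
    (insert f.leadingCoeff⁻¹ ((Finset.range (f.natDegree + 1)).image
      fun i => f.coeff i / f.leadingCoeff))
  refine ⟨r, hr0, fun u hu => ?_⟩
  by_contra hint
  let B := (integralClosure R Ω).toSubring
  have : IsIntegrallyClosedIn B Ω :=
    inferInstanceAs (IsIntegrallyClosedIn (integralClosure R Ω) Ω)
  -- The integral closure is an intersection of valuation rings, so non-integrality of `r • u` is
  -- seen by some `V`. Along the orbit the `V`-valuation then strictly increases, so the orbit is
  -- infinite.
  obtain ⟨V, hBV, hV⟩ := Subring.exists_le_valuationSubring_of_isIntegrallyClosedIn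
    (R := B) (x := r • u) hint
  have hmem : ∀ x : Ω, IsIntegral R (r • x) → algebraMap R Ω r * x ∈ V := fun x hx => by
    rw [← Algebra.smul_def]
    exact hBV hx
  have hcoeff : ∀ i, algebraMap R Ω r * (f.coeff i / f.leadingCoeff) ∈ V := by
    intro i
    by_cases hi : i ≤ f.natDegree
    · exact hmem _ (hr _ (Finset.mem_insert_of_mem (Finset.mem_image_of_mem _
        (Finset.mem_range.2 (by omega)))))
    · rw [Polynomial.coeff_eq_zero_of_natDegree_lt (not_le.1 hi), zero_div, mul_zero]
      exact V.zero_mem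
  have hstep : ∀ w : Ω, 1 < V.valuation (algebraMap R Ω r * w) →
      V.valuation w < V.valuation (f.eval w) := fun w hw =>
    valuation_lt_valuation_eval V hf (hBV (algebraMap_mem (integralClosure R Ω) r))
      ((map_ne_zero_iff _ (FaithfulSMul.algebraMap_injective R Ω)).2 hr0) hcoeff
      (hmem _ (hr _ (Finset.mem_insert_self _ _))) hw
  have hu1 : 1 < V.valuation (algebraMap R Ω r * u) := by
    rw [← Algebra.smul_def, ← not_le, V.valuation_le_one_iff]
    exact hV
  have hbig : ∀ n, 1 < V.valuation (algebraMap R Ω r * (fun w => f.eval w)^[n] u) := by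
    intro n
    induction n with
    | zero => exact hu1
    | succ n ih =>
      refine ih.trans_le ?_
      rw [map_mul, map_mul, Function.iterate_succ_apply']
      gcongr
      exact (hstep _ ih).le
  have hmono : StrictMono fun n => V.valuation ((fun w => f.eval w)^[n] u) :=
    strictMono_nat_of_lt_succ fun n => by
      rw [Function.iterate_succ_apply']
      exact hstep _ (hbig n)
  have hinj : Function.Injective fun n => (fun w => f.eval w)^[n] u := fun m n hmn =>
    hmono.injective (congrArg V.valuation hmn)
  exact Set.infinite_range_of_injective hinj hu

/-- Scaling the roots of the minimal polynomial of `u` by `r` gives that of `r • u`, whose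
coefficients lie in `R` because `R` is integrally closed. -/
theorem coeff_minpoly_mul_pow_mem_range {R k Ω : Type*} [CommRing R] [IsDomain R]
    [IsIntegrallyClosed R] [Field k] [Field Ω] [Algebra R k] [IsFractionRing R k] [Algebra k Ω]
    [Algebra R Ω] [IsScalarTower R k Ω] {r : R} (hr : r ≠ 0) {u : Ω} (hu : IsIntegral R (r • u))
    (i : ℕ) :
    (minpoly k u).coeff i * algebraMap R k r ^ ((minpoly k u).natDegree - i) ∈
      (algebraMap R k).range := by
  have hr' : algebraMap R k r ≠ 0 :=
    (map_ne_zero_iff _ (IsFractionRing.injective R k)).2 hr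
  have huk : IsIntegral k u := by
    have := (hu.tower_top (A := k)).smul (algebraMap R k r)⁻¹
    rwa [← algebraMap_smul k r u, smul_smul, inv_mul_cancel₀ hr', one_smul] at this
  have h1 := IsIntegrallyClosed.minpoly_smul hr' huk
  rw [algebraMap_smul, minpoly.isIntegrallyClosed_eq_field_fractions' k hu] at h1
  refine ⟨(minpoly R (r • u)).coeff i, ?_⟩
  rw [← Polynomial.coeff_map, h1, Polynomial.coeff_scaleRoots]

variable {F : Type*} [Field F] [Finite F]

-- The first condition makes `x * a` a polynomial, and regularity of `x * b` at infinity bounds its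
-- degree; over a finite field only finitely many remain.
open Classical in
theorem finite_ratFunc_bounded {a b : F⟮X⟯} (ha : a ≠ 0) (hb : b ≠ 0) :
    {x : F⟮X⟯ | x * a ∈ (algebraMap F[X] F⟮X⟯).range ∧
      x * b ∈ (RatFunc.inftyValuation F).valuationSubring}.Finite := by
  set d : ℕ := (RatFunc.intDegree a - RatFunc.intDegree b).toNat with hd
  have hfin : (Polynomial.degreeLT F (d + 1) : Set F[X]).Finite := by
    have : Finite (Polynomial.degreeLT F (d + 1)) :=
      Finite.of_equiv _ (Polynomial.degreeLTEquiv F (d + 1)).symm.toEquiv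
    exact Set.toFinite _
  refine (hfin.image fun g => algebraMap F[X] F⟮X⟯ g / a).subset ?_
  rintro x ⟨⟨g, hg⟩, hx⟩
  refine ⟨g, ?_, by dsimp only; rw [hg, mul_div_cancel_right₀ _ ha]⟩
  by_cases hx0 : x = 0
  · have : g = 0 := by
      rw [hx0, zero_mul] at hg
      exact (map_eq_zero_iff _ (IsFractionRing.injective F[X] F⟮X⟯)).1 hg
    rw [this]
    exact Submodule.zero_mem _
  have h1 : RatFunc.intDegree x + RatFunc.intDegree a = g.natDegree := by
    rw [← RatFunc.intDegree_mul hx0 ha, ← hg, RatFunc.intDegree_polynomial]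
  have h2 : RatFunc.intDegree x + RatFunc.intDegree b ≤ 0 := by
    rw [← RatFunc.intDegree_mul hx0 hb]
    rwa [Valuation.mem_valuationSubring_iff, RatFunc.inftyValuation_apply,
      RatFunc.inftyValuation_of_nonzero F (mul_ne_zero hx0 hb), ← WithZero.exp_zero,
      WithZero.exp_le_exp] at hx
  rw [SetLike.mem_coe, Polynomial.mem_degreeLT]
  refine lt_of_le_of_lt Polynomial.degree_le_natDegree ?_
  exact_mod_cast (show g.natDegree < d + 1 by omega)

/-- A set of preperiodic points of bounded degree over `F(X)` is finite. -/
theorem finite_preperiodic {Ω : Type*} [Field Ω] [Algebra F⟮X⟯ Ω] [Algebra.IsAlgebraic F⟮X⟯ Ω]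
    {f : Polynomial Ω} (hf : 2 ≤ f.natDegree) (D : ℕ) :
    {u : Ω | (minpoly F⟮X⟯ u).natDegree ≤ D ∧
      (Set.range fun n => (fun w => f.eval w)^[n] u).Finite}.Finite := by
  classical
  let V := (RatFunc.inftyValuation F).valuationSubring
  let _ : Algebra F[X] Ω := ((algebraMap F⟮X⟯ Ω).comp (algebraMap F[X] F⟮X⟯)).toAlgebra
  have : IsScalarTower F[X] F⟮X⟯ Ω := .of_algebraMap_eq fun _ => rfl
  let _ : Algebra V Ω := ((algebraMap F⟮X⟯ Ω).comp (algebraMap V F⟮X⟯)).toAlgebra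
  have : @IsScalarTower V F⟮X⟯ Ω Algebra.toSMul _ _ := .of_algebraMap_eq fun _ => rfl
  have : Algebra.IsAlgebraic F[X] Ω := (IsFractionRing.comap_isAlgebraic_iff (K := F⟮X⟯)).2 ‹_›
  have : Algebra.IsAlgebraic V Ω := (IsFractionRing.comap_isAlgebraic_iff (K := F⟮X⟯)).2 ‹_›
  have : FaithfulSMul F[X] Ω := (faithfulSMul_iff_algebraMap_injective _ _).2
    ((algebraMap F⟮X⟯ Ω).injective.comp (IsFractionRing.injective F[X] F⟮X⟯))
  have : FaithfulSMul V Ω := (faithfulSMul_iff_algebraMap_injective _ _).2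
    ((algebraMap F⟮X⟯ Ω).injective.comp (IsFractionRing.injective V F⟮X⟯))
  obtain ⟨r, hr0, hr⟩ := exists_smul_isIntegral_of_finite_orbit (R := F[X]) hf
  obtain ⟨s, hs0, hs⟩ := exists_smul_isIntegral_of_finite_orbit (R := V) hf
  have hr0' : algebraMap F[X] F⟮X⟯ r ≠ 0 :=
    (map_ne_zero_iff _ (IsFractionRing.injective F[X] F⟮X⟯)).2 hr0
  have hs0' : algebraMap V F⟮X⟯ s ≠ 0 :=
    (map_ne_zero_iff _ (IsFractionRing.injective V F⟮X⟯)).2 hs0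
  -- The exponent `j` stands for `deg - i` in the `i`th coefficient of a minimal polynomial.
  let Z : Set F⟮X⟯ := ⋃ j ∈ Set.Iic D, {x : F⟮X⟯ |
    x * algebraMap F[X] F⟮X⟯ r ^ j ∈ (algebraMap F[X] F⟮X⟯).range ∧
      x * algebraMap V F⟮X⟯ s ^ j ∈ V}
  have hZ : Z.Finite := (Set.finite_Iic D).biUnion fun j _ =>
    finite_ratFunc_bounded (pow_ne_zero j hr0') (pow_ne_zero j hs0')
  refine (Polynomial.bUnion_roots_finite (algebraMap F⟮X⟯ Ω) D hZ).subset ?_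
  rintro u ⟨huD, hu⟩
  have hint : IsIntegral F⟮X⟯ u := (Algebra.IsAlgebraic.isAlgebraic u).isIntegral
  simp only [Set.mem_iUnion, exists_prop]
  refine ⟨minpoly F⟮X⟯ u, ⟨huD, fun i => ?_⟩, ?_⟩
  · refine Set.mem_biUnion (x := (minpoly F⟮X⟯ u).natDegree - i)
      (show _ ≤ D from (Nat.sub_le _ _).trans huD) ⟨?_, ?_⟩
    · exact coeff_minpoly_mul_pow_mem_range hr0 (hr u hu) i
    · obtain ⟨y, hy⟩ := coeff_minpoly_mul_pow_mem_range (k := F⟮X⟯) hs0 (hs u hu) i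
      rw [← hy]
      exact y.2
  · rw [Finset.mem_coe, Multiset.mem_toFinset, Polynomial.mem_roots
      (Polynomial.map_ne_zero (minpoly.ne_zero hint)), Polynomial.IsRoot.def,
      Polynomial.eval_map_algebraMap, minpoly.aeval]

end Northcott

/-! ### Torsion modules over a Dedekind domain. -/

section DedekindModule

variable {A : Type*} [CommRing A] [IsDedekindDomain A] {N : Type*} [AddCommGroup N] [Module A N]

theorem isCoprime_of_prime_of_not_dvd {p Q : Ideal A} (hp : Prime p) (h : ¬p ∣ Q) :
    IsCoprime p Q := by
  have := (Ideal.isPrime_of_prime hp).isMaximal hp.ne_zero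
  rw [Ideal.isCoprime_iff_sup_eq]
  by_contra hne
  exact h (Ideal.dvd_iff_le.2 (sup_eq_left.1 (this.eq_of_le hne le_sup_left).symm))

/-- A module over a Dedekind domain whose annihilator is a nonzero ideal `I` contains an element
whose annihilator is `I`. -/
theorem exists_forall_smul_eq_zero_imp_mem {I : Ideal A} (hI : I ≠ ⊥)
    (hann : ∀ a : A, (∀ n : N, a • n = 0) ↔ a ∈ I) :
    ∃ x : N, ∀ a : A, a • x = 0 → a ∈ I := by
  classical
  -- Local data at each prime `p` dividing `I`: an `n` not killed by `I / p`, witnessed by `a`, and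
  -- an element `z` which is `1` modulo `p ^ e` and `0` modulo the part `Q` of `I` prime to `p`. The
  -- sum of the `z • n` is the element sought: `a p` acts on it as on `n p` alone.
  have hfac : ∀ p : Ideal A, Prime p ∧ p ∣ I → ∃ (Ip : Ideal A) (e : ℕ) (Q : Ideal A) (a : A)
      (n : N) (z : A), I = p * Ip ∧ I = p ^ e * Q ∧ ¬p ∣ Q ∧ a ∈ Ip ∧ a • n ≠ 0 ∧ z ∈ Q ∧
        1 - z ∈ p ^ e := by
    rintro p ⟨hp, Ip, hIp⟩
    obtain ⟨Q, hQ, hpQ⟩ := (FiniteMultiplicity.of_not_isUnit hp.not_isUnit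
      (show I ≠ 0 from hI)).exists_eq_pow_mul_and_not_dvd
    have hcop := (isCoprime_of_prime_of_not_dvd hp hpQ).pow_left (m := multiplicity p I)
    obtain ⟨w, hw, z, hz, hwz⟩ := Submodule.mem_sup.1
      ((Ideal.eq_top_iff_one _).1 (Ideal.isCoprime_iff_sup_eq.1 hcop))
    have hlt : ¬Ip ≤ I := by
      intro hle
      obtain ⟨D, hD⟩ := Ideal.dvd_iff_le.2 hle
      have hIp0 : Ip ≠ 0 := by rintro rfl; exact hI (by rw [hIp, mul_zero]; rfl)
      refine hp.not_isUnit (IsUnit.of_mul_eq_one D (mul_right_cancel₀ hIp0 ?_))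
      rw [one_mul, mul_right_comm, ← hIp, ← hD]
    obtain ⟨a, ha, haI⟩ := SetLike.not_le_iff_exists.1 hlt
    rw [← hann, not_forall] at haI
    obtain ⟨n, hn⟩ := haI
    refine ⟨Ip, _, Q, a, n, z, hIp, hQ, hpQ, ha, hn, hz, ?_⟩
    rwa [← hwz, add_sub_cancel_right]
  choose! Ip e Q a n z hIp hQ hpQ ha hn hz hw using hfac
  set S := (UniqueFactorizationMonoid.normalizedFactors I).toFinset
  have hS : ∀ p, p ∈ S ↔ Prime p ∧ p ∣ I := fun p => by
    rw [Multiset.mem_toFinset, UniqueFactorizationMonoid.mem_normalizedFactors_iff hI]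
  have hkill : ∀ a ∈ I, ∀ n : N, a • n = 0 := fun a ha => (hann a).2 ha
  let x : N := ∑ p ∈ S, z p • n p
  have hself : ∀ p ∈ S, a p • z p • n p = a p • n p := by
    intro p hpS
    have hp := (hS p).1 hpS
    have hle : Ip p ≤ Q p := by
      refine Ideal.dvd_iff_le.1 ((isCoprime_of_prime_of_not_dvd hp.1 (hpQ p hp)).symm.dvd_of_dvd_mul_left
        (Dvd.intro_left (p ^ e p) ?_))
      rw [← hIp p hp, ← hQ p hp]
    have : (a p * (1 - z p)) • n p = 0 := by
      refine hkill _ ?_ _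
      rw [hQ p hp, mul_comm (a p)]
      exact Ideal.mul_mem_mul (hw p hp) (hle (ha p hp))
    rw [mul_sub, mul_one, sub_smul, sub_eq_zero] at this
    rw [this, mul_smul]
  have hother : ∀ p ∈ S, ∀ q ∈ S, q ≠ p → a p • z q • n q = 0 := by
    intro p hpS q hqS hqp
    have hp := (hS p).1 hpS
    have hq := (hS q).1 hqS
    have hcop : IsCoprime (q ^ e q) p := by
      refine (isCoprime_of_prime_of_not_dvd hq.1 fun h => hqp ?_).pow_left
      exact associated_iff_eq.1 ((hq.1.dvd_prime_iff_associated hp.1).1 h)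
    have hle : Ip p ≤ q ^ e q := by
      refine Ideal.dvd_iff_le.1 (hcop.dvd_of_dvd_mul_left (Dvd.intro (Q q) ?_))
      rw [← hIp p hp, ← hQ q hq]
    rw [smul_smul]
    refine hkill _ ?_ _
    rw [hQ q hq]
    exact Ideal.mul_mem_mul (hle (ha p hp)) (hz q hq)
  refine ⟨x, ?_⟩
  let D : Ideal A := LinearMap.ker (LinearMap.toSpanSingleton A N x)
  have hD : ∀ b, b ∈ D ↔ b • x = 0 := fun b => Iff.rfl
  obtain ⟨D', hD'⟩ := Ideal.dvd_iff_le.2 (show I ≤ D from fun b hb => hkill b hb x)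
  suffices hunit : IsUnit D' by
    intro b hb
    rw [hD', Ideal.isUnit_iff.1 hunit, Ideal.mul_top]
    exact hb
  by_contra hunit
  have hD'0 : D' ≠ 0 := by rintro rfl; exact hI (by rw [hD', mul_zero]; rfl)
  -- If the annihilator `D` strictly contained `I`, it would contain `I / p` for some `p`, hence `a
  -- p`, contradicting `a p • n p ≠ 0`.
  obtain ⟨p, hp, D'', rfl⟩ := WfDvdMonoid.exists_irreducible_factor hunit hD'0
  have hpS : Prime p ∧ p ∣ I := ⟨hp.prime, D * D'', by rw [hD', mul_left_comm]⟩
  have hle : Ip p ≤ D := by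
    refine Ideal.dvd_iff_le.1 ⟨D'', mul_left_cancel₀ hp.ne_zero ?_⟩
    rw [← hIp p hpS, mul_left_comm, ← hD']
  have h0 := (hD _).1 (hle (ha p hpS))
  rw [Finset.smul_sum, Finset.sum_eq_single p (fun q hq hqp => hother p ((hS p).2 hpS) q hq hqp)
    (fun h => absurd ((hS p).2 hpS) h), hself p ((hS p).2 hpS)] at h0
  exact hn p hpS h0

/-- If `N[c]` is no larger than `A / c` and only the multiples of `c` annihilate it, then every
submodule of `N[c]` is the `b`-torsion of `N` for some ideal `b`. -/
theorem exists_forall_mem_iff_smul_eq_zero {c : A} (hc : c ≠ 0) [Finite (A ⧸ Ideal.span {c})]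
    (hcard : {n : N | c • n = 0}.ncard ≤ Nat.card (A ⧸ Ideal.span {c}))
    (hfin : {n : N | c • n = 0}.Finite)
    (hann : ∀ a : A, (∀ n : N, c • n = 0 → a • n = 0) → c ∣ a)
    (M : Submodule A N) (hM : ∀ n ∈ M, c • n = 0) :
    ∃ b : Ideal A, b ≠ ⊥ ∧ ∀ n : N, n ∈ M ↔ ∀ a ∈ b, a • n = 0 := by
  obtain ⟨x, hx⟩ := exists_forall_smul_eq_zero_imp_mem (N := Submodule.torsionBy A N c) (I := Ideal.span {c})
    (by simpa using hc) (fun a => by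
      rw [Ideal.mem_span_singleton]
      refine ⟨fun h => hann a fun n hn => ?_, ?_⟩
      · exact congrArg Subtype.val (h ⟨n, (Submodule.mem_torsionBy_iff c n).2 hn⟩)
      · rintro ⟨k, rfl⟩ n
        rw [mul_comm, mul_smul]
        exact (congrArg (k • ·) (Submodule.smul_torsionBy c n)).trans (smul_zero k))
  set y : N := x.1 with hy
  have hcy : c • y = 0 := (Submodule.mem_torsionBy_iff c y).1 x.2
  have hann' : ∀ a : A, a • y = 0 ↔ a ∈ Ideal.span {c} := by
    refine fun a => ⟨fun h => hx a (Subtype.ext h), fun h => ?_⟩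
    obtain ⟨k, rfl⟩ := Ideal.mem_span_singleton.1 h
    rw [mul_comm, mul_smul, hcy, smul_zero]
  let φ : A ⧸ Ideal.span {c} → N := Submodule.liftQ (Ideal.span {c}) (LinearMap.toSpanSingleton A N y)
    fun a ha => (hann' a).2 ha
  have hφ : ∀ a : A, φ (Ideal.Quotient.mk _ a) = a • y := fun a => rfl
  have hinj : Function.Injective φ := by
    intro a b hab
    obtain ⟨a, rfl⟩ := Ideal.Quotient.mk_surjective a
    obtain ⟨b, rfl⟩ := Ideal.Quotient.mk_surjective b
    rw [hφ, hφ, ← sub_eq_zero, ← sub_smul, hann'] at hab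
    exact Ideal.Quotient.eq.2 hab
  -- `A / c` embeds in `N[c]`, and the cardinality bound makes the embedding onto: `N[c]` is
  -- generated by `y`.
  have hrange : Set.range φ = {n : N | c • n = 0} := by
    refine Set.eq_of_subset_of_ncard_le ?_ ?_ hfin
    · rintro _ ⟨a, rfl⟩
      obtain ⟨a, rfl⟩ := Ideal.Quotient.mk_surjective a
      change c • φ _ = 0
      rw [hφ, smul_comm, hcy, smul_zero]
    · rwa [← Set.image_univ, Set.ncard_image_of_injective _ hinj, Set.ncard_univ]
  have hgen : ∀ n : N, c • n = 0 → ∃ a : A, n = a • y := by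
    intro n hn
    obtain ⟨a, ha⟩ := hrange.symm ▸ (show n ∈ {n : N | c • n = 0} from hn)
    obtain ⟨a, rfl⟩ := Ideal.Quotient.mk_surjective a
    exact ⟨a, ha ▸ hφ a⟩
  let J : Ideal A := M.comap (LinearMap.toSpanSingleton A N y)
  have hJ : ∀ a, a ∈ J ↔ a • y ∈ M := fun a => Iff.rfl
  have hcJ : Ideal.span {c} ≤ J := by
    rw [Ideal.span_singleton_le_iff_mem, hJ, hcy]
    exact M.zero_mem
  -- With `(c) = J b`, the element `a • y` is killed by `b` iff `a b ⊆ J b`, which by cancellation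
  -- means `a ∈ J`, that is `a • y ∈ M`.
  obtain ⟨b, hb⟩ := Ideal.dvd_iff_le.2 hcJ
  have hspan : Ideal.span {c} ≠ ⊥ := by simpa using hc
  have hJ0 : J ≠ ⊥ := by rintro h; rw [h, Ideal.bot_mul] at hb; exact hspan hb
  have hb0 : b ≠ ⊥ := by rintro h; rw [h, Ideal.mul_bot] at hb; exact hspan hb
  have hcb : c ∈ b := (hb.le.trans Ideal.mul_le_right) (Ideal.mem_span_singleton_self c)
  refine ⟨b, hb0, fun n => ⟨fun hn a ha => ?_, fun hn => ?_⟩⟩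
  · obtain ⟨k, rfl⟩ := hgen n (hM n hn)
    rw [smul_smul, hann', hb, mul_comm a]
    exact Ideal.mul_mem_mul ((hJ k).2 hn) ha
  · obtain ⟨k, rfl⟩ := hgen n (hn c hcb)
    rw [← hJ, ← Ideal.span_singleton_le_iff_mem, ← Ideal.dvd_iff_le]
    refine (mul_dvd_mul_iff_right (show b ≠ 0 from hb0)).1 ?_
    rw [← hb, Ideal.dvd_iff_le, Ideal.span_singleton_mul_le_iff]
    intro a ha
    rw [← hann', mul_comm, mul_smul]
    exact hn a ha

end DedekindModule

/-! ### Counting a subring by pole order. -/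

section Filtration

variable {K : Type*} [Field K]

/-- The subgroup `c G` of a field, for `c ≠ 0`. -/
def scale (c : K) (G : AddSubgroup K) : AddSubgroup K := G.comap (AddMonoidHom.mulLeft c⁻¹)

theorem mem_scale {c : K} {G : AddSubgroup K} {x : K} : x ∈ scale c G ↔ c⁻¹ * x ∈ G := Iff.rfl

theorem relIndex_scale {c : K} (hc : c ≠ 0) (G H : AddSubgroup K) :
    (scale c G).relIndex (scale c H) = G.relIndex H := by
  rw [scale, scale, AddSubgroup.relIndex_comap, AddSubgroup.map_comap_eq_self_of_surjective]
  exact fun x => ⟨c * x, inv_mul_cancel_left₀ hc x⟩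

theorem scale_bot {c : K} (hc : c ≠ 0) : scale c (⊥ : AddSubgroup K) = ⊥ := by
  ext x
  simp [mem_scale, hc]

theorem card_scale {c : K} (hc : c ≠ 0) (G : AddSubgroup K) :
    Nat.card (scale c G) = Nat.card G := by
  rw [← AddSubgroup.relIndex_bot_left, ← AddSubgroup.relIndex_bot_left, ← relIndex_scale hc ⊥ G,
    scale_bot hc]

theorem card_quotient_span_singleton (S : Subring K) (c : S) (hc : (c : K) ≠ 0) :
    Nat.card (S ⧸ Ideal.span {c}) =
      (scale (c : K) S.toAddSubgroup).relIndex S.toAddSubgroup := by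
  have : (scale (c : K) S.toAddSubgroup).addSubgroupOf S.toAddSubgroup =
      (Ideal.span {c}).toAddSubgroup := by
    refine AddSubgroup.ext fun (x : S) => ?_
    refine AddSubgroup.mem_addSubgroupOf.trans
      (Iff.trans ?_ (Ideal.mem_span_singleton (α := S)).symm)
    constructor
    · intro h
      exact ⟨⟨_, h⟩, Subtype.ext (mul_inv_cancel_left₀ hc (x : K)).symm⟩
    · rintro ⟨y, rfl⟩
      change (c : K)⁻¹ * (c * y) ∈ S
      rw [inv_mul_cancel_left₀ hc]
      exact y.2
  rw [AddSubgroup.relIndex, this]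
  rfl

variable (O : ValuationSubring K) (c : K)

/-- The subgroup `c ^ j O` of `K`. -/
def poleFiltration (j : ℤ) : AddSubgroup K := scale (c ^ j) O.toSubring.toAddSubgroup

variable {O c}

theorem mem_poleFiltration {j : ℤ} {x : K} :
    x ∈ poleFiltration O c j ↔ c ^ (-j) * x ∈ O := by
  rw [poleFiltration, mem_scale, zpow_neg]
  rfl

theorem mul_mem_poleFiltration (hc : c ≠ 0) {j : ℤ} {x : K} :
    c * x ∈ poleFiltration O c (j + 1) ↔ x ∈ poleFiltration O c j := by
  rw [mem_poleFiltration, mem_poleFiltration, ← mul_assoc, ← zpow_add_one₀ hc]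
  congr! 3
  ring

theorem scale_poleFiltration (hc : c ≠ 0) (j : ℤ) :
    scale c (poleFiltration O c j) = poleFiltration O c (j + 1) := by
  ext x
  rw [mem_scale, ← mul_mem_poleFiltration hc, mul_inv_cancel_left₀ hc]

theorem poleFiltration_mono (hc : c ≠ 0) (hcO : c⁻¹ ∈ O) : Monotone (poleFiltration O c) := by
  refine monotone_int_of_le_succ fun j x hx => ?_
  rw [mem_poleFiltration] at hx ⊢
  rw [neg_add, zpow_add₀ hc, zpow_neg_one, mul_comm (c ^ (-j)), mul_assoc]
  exact mul_mem hcO hx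

/-- Multiplication by `c` shifts the filtration, so every step has the index of `c⁻¹ O` in `O`,
written below with `-1` and `-1 + 1`. -/
theorem relIndex_poleFiltration (hc : c ≠ 0) (i j : ℤ) :
    (poleFiltration O c i).relIndex (poleFiltration O c (i + 1)) =
      (poleFiltration O c j).relIndex (poleFiltration O c (j + 1)) := by
  suffices H : ∀ i : ℤ, (poleFiltration O c i).relIndex (poleFiltration O c (i + 1)) =
      (poleFiltration O c 0).relIndex (poleFiltration O c (0 + 1)) by rw [H i, H j]
  intro i
  induction i using Int.induction_on with
  | zero => rfl
  | succ i ih => rw [← ih, ← scale_poleFiltration hc, ← scale_poleFiltration hc,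
      relIndex_scale hc, scale_poleFiltration hc]
  | pred i ih =>
    rw [← ih, ← relIndex_scale hc, scale_poleFiltration hc, scale_poleFiltration hc,
      sub_add_cancel]

variable {R : Subring K}

variable (O c R) in
/-- The elements of `R` lying in `c ^ j O`. -/
def poleBounded (j : ℤ) : AddSubgroup K := R.toAddSubgroup ⊓ poleFiltration O c j

theorem scale_poleBounded (hc : c ≠ 0) (hcR : c ∈ R) (j : ℤ) :
    scale c (poleBounded O c R j) = scale c R.toAddSubgroup ⊓ poleBounded O c R (j + 1) := by
  ext x
  rw [poleBounded, poleBounded, ← scale_poleFiltration hc]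
  simp only [AddSubgroup.mem_inf, mem_scale]
  refine ⟨fun h => ⟨h.1, ?_, h.2⟩, fun h => ⟨h.1, h.2.2⟩⟩
  simpa [hc] using R.mul_mem hcR h.1

theorem scale_le (hc : c ≠ 0) (hcR : c ∈ R) : scale c R.toAddSubgroup ≤ R.toAddSubgroup :=
  fun x hx => by simpa [hc] using R.mul_mem hcR hx

/-- Passing from `c ^ j O` to `c ^ (j + 1) O` enlarges `R ∩ c ^ j O` by a factor of at most
`#(c O / O)`. -/
theorem relIndex_poleBounded (hc : c ≠ 0) (hcO : c⁻¹ ∈ O) (j : ℤ) :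
    (poleBounded O c R j).relIndex (poleBounded O c R (j + 1)) =
      (poleFiltration O c j).relIndex (poleBounded O c R (j + 1)) := by
  rw [← AddSubgroup.inf_relIndex_right (poleFiltration O c j)]
  congr 1
  rw [poleBounded, poleBounded, inf_left_comm,
    inf_eq_left.2 (poleFiltration_mono hc hcO (by omega : j ≤ j + 1))]

theorem relIndex_poleBounded_ne_zero (hc : c ≠ 0) (hcO : c⁻¹ ∈ O)
    (hB : (poleFiltration O c (-1)).relIndex (poleFiltration O c (-1 + 1)) ≠ 0) (j : ℤ) :
    (poleBounded O c R j).relIndex (poleBounded O c R (j + 1)) ≠ 0 := by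
  rw [relIndex_poleBounded hc hcO]
  rw [relIndex_poleFiltration hc _ j] at hB
  exact mt (AddSubgroup.relIndex_eq_zero_of_le_right inf_le_right) hB

theorem relIndex_poleBounded_le (hc : c ≠ 0) (hcO : c⁻¹ ∈ O)
    (hB : (poleFiltration O c (-1)).relIndex (poleFiltration O c (-1 + 1)) ≠ 0) (j : ℤ) :
    (poleBounded O c R j).relIndex (poleBounded O c R (j + 1)) ≤
      (poleFiltration O c (-1)).relIndex (poleFiltration O c (-1 + 1)) := by
  rw [relIndex_poleBounded hc hcO]
  rw [relIndex_poleFiltration hc _ j] at hB ⊢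
  exact AddSubgroup.relIndex_le_of_le_right inf_le_right hB

theorem poleBounded_mono (hc : c ≠ 0) (hcO : c⁻¹ ∈ O) : Monotone (poleBounded O c R) :=
  fun _ _ hij => inf_le_inf_left _ (poleFiltration_mono hc hcO hij)

/-- The filtration of `R` starts at zero in degree `-1` and grows by finite steps, so all its terms
are finite; a `Nat.card` of `0` would mean an infinite one. -/
theorem card_poleBounded_ne_zero (hc : c ≠ 0) (hcO : c⁻¹ ∈ O)
    (hB : (poleFiltration O c (-1)).relIndex (poleFiltration O c (-1 + 1)) ≠ 0)
    (h0 : ∀ x ∈ R, x ∈ poleFiltration O c (-1) → x = 0) (n : ℕ) :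
    Nat.card (poleBounded O c R (n - 1)) ≠ 0 := by
  induction n with
  | zero =>
    have : poleBounded O c R ((0 : ℕ) - 1) = ⊥ := by
      rw [eq_bot_iff]
      exact fun x hx => h0 x hx.1 hx.2
    rw [this]
    simp
  | succ n ih =>
    have h1 := AddSubgroup.relIndex_mul_relIndex ⊥ _ _ bot_le
      (poleBounded_mono (R := R) hc hcO (by omega : (n : ℤ) - 1 ≤ n - 1 + 1))
    rw [AddSubgroup.relIndex_bot_left, AddSubgroup.relIndex_bot_left] at h1
    rw [show ((n + 1 : ℕ) : ℤ) - 1 = n - 1 + 1 by push_cast; ring, ← h1]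
    exact mul_ne_zero ih (relIndex_poleBounded_ne_zero hc hcO hB _)

/-- Write `R_n = R ∩ c ^ n O`. Both `R_{n-1}` and `c R_{n-1} = c R ∩ R_n` are subgroups of `R_n` of
the same finite order, hence of the same index. -/
theorem relIndex_scale_poleBounded (hc : c ≠ 0) (hcR : c ∈ R) (hcO : c⁻¹ ∈ O)
    (hB : (poleFiltration O c (-1)).relIndex (poleFiltration O c (-1 + 1)) ≠ 0)
    (h0 : ∀ x ∈ R, x ∈ poleFiltration O c (-1) → x = 0) (n : ℕ) :
    (scale c R.toAddSubgroup).relIndex (poleBounded O c R n) =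
      (poleFiltration O c (n - 1)).relIndex (poleBounded O c R n) := by
  have h1 := AddSubgroup.relIndex_mul_relIndex ⊥ _ _ bot_le
    (poleBounded_mono (R := R) hc hcO (by omega : (n : ℤ) - 1 ≤ n - 1 + 1))
  have h2 := AddSubgroup.relIndex_mul_relIndex ⊥ _ _ bot_le
    (inf_le_right : scale c R.toAddSubgroup ⊓ poleBounded O c R (n - 1 + 1) ≤ _)
  rw [AddSubgroup.inf_relIndex_right, ← scale_poleBounded hc hcR] at h2
  rw [AddSubgroup.relIndex_bot_left, AddSubgroup.relIndex_bot_left] at h1 h2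
  rw [card_scale hc, ← h1] at h2
  have h3 := Nat.eq_of_mul_eq_mul_left
    (Nat.pos_of_ne_zero (card_poleBounded_ne_zero hc hcO hB h0 n)) h2
  rwa [relIndex_poleBounded hc hcO, sub_add_cancel] at h3

/-- If the nonzero elements of `R` do not vanish at the place with valuation ring `O`, then `R / c`
is represented by elements of bounded pole order. -/
theorem exists_le_poleBounded_sup (hc : c ≠ 0) (hcR : c ∈ R) (hcO : c⁻¹ ∈ O)
    (hB : (poleFiltration O c (-1)).relIndex (poleFiltration O c (-1 + 1)) ≠ 0)
    (h0 : ∀ x ∈ R, x ∈ poleFiltration O c (-1) → x = 0)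
    (hun : ∀ x : K, ∃ n : ℕ, x ∈ poleFiltration O c n) :
    ∃ N : ℕ, ∀ n : ℕ, N ≤ n → R.toAddSubgroup ≤ poleBounded O c R n ⊔ scale c R.toAddSubgroup := by
  set H := scale c R.toAddSubgroup with hH
  let f : ℕ → ℕ := fun n => H.relIndex (poleBounded O c R n)
  have hf : ∀ n, f n = (poleFiltration O c (n - 1)).relIndex (poleBounded O c R n) := fun n =>
    relIndex_scale_poleBounded hc hcR hcO hB h0 n
  have hf' : ∀ n, f n = (poleBounded O c R (n - 1)).relIndex (poleBounded O c R (n - 1 + 1)) :=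
    fun n => by rw [relIndex_poleBounded hc hcO, hf, sub_add_cancel]
  have hbdd : BddAbove (Set.range f) :=
    ⟨_, by rintro _ ⟨n, rfl⟩; rw [hf']; exact relIndex_poleBounded_le hc hcO hB _⟩
  -- `f n` counts the image of `R_n` in `R / c`. These images increase and have bounded size, so
  -- they are constant from a maximum of `f` on.
  obtain ⟨N, hN⟩ := Nat.sSup_mem (Set.range_nonempty f) hbdd
  have hmax : ∀ n, f n ≤ f N := fun n => hN ▸ le_csSup hbdd ⟨n, rfl⟩
  have hstep : ∀ n : ℕ, N ≤ n → poleBounded O c R n ≤ poleBounded O c R N ⊔ H := by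
    intro n hn
    have hle : poleBounded O c R N ⊔ H ≤ poleBounded O c R n ⊔ H :=
      sup_le_sup_right (poleBounded_mono hc hcO (by exact_mod_cast hn)) H
    have h1 := AddSubgroup.relIndex_mul_relIndex H _ _ le_sup_right hle
    rw [AddSubgroup.relIndex_sup_right, AddSubgroup.relIndex_sup_right] at h1
    have hpos : 0 < f N := Nat.pos_of_ne_zero
      (by rw [hf']; exact relIndex_poleBounded_ne_zero hc hcO hB _)
    have hpos' : 0 < f n := Nat.pos_of_ne_zero
      (by rw [hf']; exact relIndex_poleBounded_ne_zero hc hcO hB _)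
    have h2 : (poleBounded O c R N ⊔ H).relIndex (poleBounded O c R n ⊔ H) = 1 := by
      have h3 : f N * (poleBounded O c R N ⊔ H).relIndex (poleBounded O c R n ⊔ H) ≤ f N * 1 := by
        rw [mul_one]
        exact h1.le.trans (hmax n)
      have h4 := Nat.le_of_mul_le_mul_left h3 hpos
      rcases Nat.le_one_iff_eq_zero_or_eq_one.1 h4 with h5 | h5
      · rw [h5, mul_zero] at h1
        exact absurd h1 hpos'.ne
      · exact h5
    exact le_sup_left.trans (AddSubgroup.relIndex_eq_one.1 h2)
  refine ⟨N, fun n hn x hx => ?_⟩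
  obtain ⟨m, hm⟩ := hun x
  have h1 : x ∈ poleBounded O c R (max N m : ℕ) :=
    ⟨hx, poleFiltration_mono hc hcO (by simp) hm⟩
  exact sup_le_sup_right (poleBounded_mono hc hcO (by exact_mod_cast hn)) H
    (hstep _ (le_max_left _ _) h1)

theorem relIndex_scale_eq (hc : c ≠ 0) (hcR : c ∈ R) (hcO : c⁻¹ ∈ O)
    (hB : (poleFiltration O c (-1)).relIndex (poleFiltration O c (-1 + 1)) ≠ 0)
    (h0 : ∀ x ∈ R, x ∈ poleFiltration O c (-1) → x = 0)
    (hun : ∀ x : K, ∃ n : ℕ, x ∈ poleFiltration O c n) :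
    ∃ N : ℕ, ∀ n : ℕ, N ≤ n → (scale c R.toAddSubgroup).relIndex R.toAddSubgroup =
      (poleFiltration O c (n - 1)).relIndex (poleBounded O c R n) := by
  obtain ⟨N, hN⟩ := exists_le_poleBounded_sup hc hcR hcO hB h0 hun
  refine ⟨N, fun n hn => ?_⟩
  have h1 : R.toAddSubgroup = poleBounded O c R n ⊔ scale c R.toAddSubgroup :=
    le_antisymm (hN n hn) (sup_le inf_le_left (scale_le hc hcR))
  have h2 := AddSubgroup.relIndex_sup_right (poleBounded O c R n) (scale c R.toAddSubgroup)
  rw [← relIndex_scale_poleBounded hc hcR hcO hB h0, ← h2, ← h1]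

theorem relIndex_scale_ne_zero (hc : c ≠ 0) (hcR : c ∈ R) (hcO : c⁻¹ ∈ O)
    (hB : (poleFiltration O c (-1)).relIndex (poleFiltration O c (-1 + 1)) ≠ 0)
    (h0 : ∀ x ∈ R, x ∈ poleFiltration O c (-1) → x = 0)
    (hun : ∀ x : K, ∃ n : ℕ, x ∈ poleFiltration O c n) :
    (scale c R.toAddSubgroup).relIndex R.toAddSubgroup ≠ 0 := by
  obtain ⟨N, hN⟩ := relIndex_scale_eq hc hcR hcO hB h0 hun
  rw [hN N le_rfl]
  have := relIndex_poleBounded_ne_zero (R := R) hc hcO hB (N - 1)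
  rwa [relIndex_poleBounded hc hcO, sub_add_cancel] at this

/-- If every element of `O` is approximated modulo `c⁻¹ O` by elements of `⋃ c⁻ⁿ R`, then `R / c`
has at least as many elements as `O / c⁻¹`. -/
theorem relIndex_poleFiltration_le (hc : c ≠ 0) (hcR : c ∈ R) (hcO : c⁻¹ ∈ O)
    (hB : (poleFiltration O c (-1)).relIndex (poleFiltration O c (-1 + 1)) ≠ 0)
    (h0 : ∀ x ∈ R, x ∈ poleFiltration O c (-1) → x = 0)
    (hun : ∀ x : K, ∃ n : ℕ, x ∈ poleFiltration O c n)
    (happrox : ∀ y ∈ O, ∃ n : ℕ, ∃ a ∈ R, y - c⁻¹ ^ n * a ∈ poleFiltration O c (-1)) :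
    (poleFiltration O c (-1)).relIndex (poleFiltration O c (-1 + 1)) ≤
      (scale c R.toAddSubgroup).relIndex R.toAddSubgroup := by
  obtain ⟨N, hN⟩ := relIndex_scale_eq hc hcR hcO hB h0 hun
  have hfin : Finite (poleFiltration O c (-1 + 1) ⧸
      (poleFiltration O c (-1)).addSubgroupOf (poleFiltration O c (-1 + 1))) :=
    Nat.finite_of_card_ne_zero hB
  have hO : ∀ y, y ∈ poleFiltration O c (-1 + 1) ↔ y ∈ O := fun y => by
    rw [mem_poleFiltration]
    simp
  choose! m a ha hma using happrox
  -- `O / c⁻¹ O` is finite, so one exponent serves all its classes. Multiplying by that power of `c`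
  -- turns the approximations into elements of `R` that fill a whole step of the filtration.
  obtain ⟨n, hn⟩ := (Set.finite_range fun q : poleFiltration O c (-1 + 1) ⧸
      (poleFiltration O c (-1)).addSubgroupOf (poleFiltration O c (-1 + 1)) =>
      m (q.out : K)).bddAbove
  have hle : poleFiltration O c (max N n : ℕ) ≤
      poleBounded O c R (max N n : ℕ) ⊔ poleFiltration O c ((max N n : ℕ) - 1) := by
    intro x hx
    set l := max N n
    have hy : c ^ (-(l : ℤ)) * x ∈ poleFiltration O c (-1 + 1) :=
      (hO _).2 (mem_poleFiltration.1 hx)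
    set y : poleFiltration O c (-1 + 1) := ⟨_, hy⟩
    set q := QuotientAddGroup.mk (s := (poleFiltration O c (-1)).addSubgroupOf
      (poleFiltration O c (-1 + 1))) y with hq
    have h1 : (q.out : K) - y ∈ poleFiltration O c (-1) := by
      have : -(y : poleFiltration O c (-1 + 1)) + q.out ∈ (poleFiltration O c (-1)).addSubgroupOf
          (poleFiltration O c (-1 + 1)) := by
        rw [← QuotientAddGroup.eq, QuotientAddGroup.out_eq']
      rw [AddSubgroup.mem_addSubgroupOf] at this
      simpa [sub_eq_neg_add] using this
    have hqO : (q.out : K) ∈ O := (hO _).1 q.out.2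
    have hml : m (q.out : K) ≤ l := (hn ⟨q, rfl⟩).trans (le_max_right _ _)
    obtain ⟨k, hk⟩ := Nat.exists_eq_add_of_le hml
    set b := c ^ k * a (q.out : K) with hb
    have h2 : x - b ∈ poleFiltration O c (l - 1) := by
      have h3 := AddSubgroup.sub_mem _ (hma _ hqO) h1
      rw [mem_poleFiltration] at h3 ⊢
      have h4 : c ^ (-((l : ℤ) - 1)) * (x - b) = c ^ (-(-1 : ℤ)) *
          ((q.out : K) - c⁻¹ ^ m (q.out : K) * a (q.out : K) - ((q.out : K) - y)) := by
        change _ = c ^ (-(-1 : ℤ)) * ((q.out : K) - c⁻¹ ^ m (q.out : K) * a (q.out : K) -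
          ((q.out : K) - c ^ (-(l : ℤ)) * x))
        have h5 : c ^ (-(l : ℤ)) * b = c⁻¹ ^ m (q.out : K) * a (q.out : K) := by
          rw [hb, ← mul_assoc]
          congr 1
          rw [zpow_neg, zpow_natCast, hk, pow_add, mul_inv, mul_assoc,
            inv_mul_cancel₀ (pow_ne_zero k hc), mul_one, inv_pow]
        rw [← h5, neg_sub, neg_neg, sub_eq_add_neg (1 : ℤ), zpow_add₀ hc]
        ring
      rwa [h4]
    refine AddSubgroup.mem_sup.2 ⟨b, ⟨R.mul_mem (R.pow_mem hcR k) (ha _ hqO), ?_⟩, x - b, h2,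
      add_sub_cancel _ _⟩
    have h6 := AddSubgroup.sub_mem _ hx
      (poleFiltration_mono hc hcO (by omega : (l : ℤ) - 1 ≤ l) h2)
    rwa [sub_sub_cancel] at h6
  have h1 : poleBounded O c R (max N n : ℕ) ⊔ poleFiltration O c ((max N n : ℕ) - 1) =
      poleFiltration O c (max N n : ℕ) :=
    le_antisymm (sup_le inf_le_right (poleFiltration_mono hc hcO (by omega))) hle
  rw [hN _ (le_max_left N n), ← AddSubgroup.relIndex_sup_right (poleBounded O c R (max N n : ℕ)), h1,
    relIndex_poleFiltration hc (-1) ((max N n : ℕ) - 1), sub_add_cancel]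


/-- A ring whose nonzero elements do not vanish at the place with valuation ring `O` is integral
over each of its subrings containing a nonconstant element. -/
theorem isIntegral_of_ne_zero {A : Subring K} (hAR : A ≤ R) (hc : c ≠ 0) (hcA : c ∈ A)
    (hcO : c⁻¹ ∈ O)
    (hB : (poleFiltration O c (-1)).relIndex (poleFiltration O c (-1 + 1)) ≠ 0)
    (h0 : ∀ x ∈ R, x ∈ poleFiltration O c (-1) → x = 0)
    (hun : ∀ x : K, ∃ n : ℕ, x ∈ poleFiltration O c n) {t : K} (ht : t ∈ R) :
    IsIntegral A t := by
  obtain ⟨N, hN⟩ := exists_le_poleBounded_sup hc (hAR hcA) hcO hB h0 hun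
  -- Iterating `R = R_N + c R`, where the factor of `c` has smaller pole order, gives `R = M`. Since
  -- `R_N` is finite, `M` is a finitely generated `A`-module stable under `t`.
  let M : Submodule A K := Submodule.span A (poleBounded O c R N)
  have hstep : ∀ n : ℕ, ∀ x ∈ poleBounded O c R (N + n : ℕ), x ∈ M := by
    intro n
    induction n with
    | zero => exact fun x hx => Submodule.subset_span hx
    | succ n ih =>
      intro x hx
      obtain ⟨v, hv, y, hy, rfl⟩ := AddSubgroup.mem_sup.1 (hN N le_rfl hx.1)
      refine M.add_mem (Submodule.subset_span hv) ?_
      have h1 : c⁻¹ * y ∈ poleBounded O c R (N + n : ℕ) := by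
        refine ⟨hy, ?_⟩
        change c⁻¹ * y ∈ poleFiltration O c _
        rw [← mul_mem_poleFiltration hc, mul_inv_cancel_left₀ hc]
        have h2 : v ∈ poleFiltration O c ((N + n : ℕ) + 1) :=
          poleFiltration_mono hc hcO (by push_cast; omega) hv.2
        have h3 := hx.2
        push_cast at h2 h3 ⊢
        rw [← add_assoc] at h3
        simpa using AddSubgroup.sub_mem _ h3 h2
      have := M.smul_mem ⟨c, hcA⟩ (ih _ h1)
      rwa [Subring.smul_def, smul_eq_mul, mul_inv_cancel_left₀ hc] at this
  have hRM : ∀ x ∈ R, x ∈ M := by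
    intro x hx
    obtain ⟨m, hm⟩ := hun x
    exact hstep m x ⟨hx, poleFiltration_mono hc hcO (by push_cast; omega) hm⟩
  have hfin : (poleBounded O c R N : Set K).Finite := by
    have := card_poleBounded_ne_zero hc hcO hB h0 (N + 1)
    push_cast at this
    rw [add_sub_cancel_right] at this
    exact Nat.finite_of_card_ne_zero this
  have hMR : ∀ x ∈ M, x ∈ R := by
    intro x hx
    induction hx using Submodule.span_induction with
    | mem x hx => exact hx.1
    | zero => exact R.zero_mem
    | add x y _ _ hx hy => exact R.add_mem hx hy
    | smul a x _ hx => exact R.mul_mem (hAR a.2) hx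
  refine isIntegral_of_smul_mem_submodule M ?_ (Submodule.fg_span hfin) t
    fun n hn => hRM _ (R.mul_mem ht (hMR n hn))
  intro h
  have := hRM 1 R.one_mem
  rw [h, Submodule.mem_bot] at this
  exact one_ne_zero this

end Filtration

/-! ### The order at a place, and the ring of functions regular outside it. -/

namespace Place

variable {F : Type*} [Field F] {K : Type*} [Field K] [Algebra F K] (P : Place F K)

theorem ord_mul {a b : K} (ha : a ≠ 0) (hb : b ≠ 0) : P.ord (a * b) = P.ord a + P.ord b := by
  rw [ord, ord, ord, map_mul, WithZero.log_mul (by simpa using ha) (by simpa using hb), neg_add]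

theorem ord_inv (a : K) : P.ord a⁻¹ = -P.ord a := by
  rw [ord, ord, map_inv₀, WithZero.log_inv]

theorem ord_zpow (a : K) (n : ℤ) : P.ord (a ^ n) = n * P.ord a := by
  rw [ord, ord, map_zpow₀, WithZero.log_zpow, smul_eq_mul, mul_neg]

theorem mem_ring_iff_ord {a : K} (ha : a ≠ 0) : a ∈ P.ring ↔ 0 ≤ P.ord a := by
  rw [ord, Left.nonneg_neg_iff, WithZero.log_le_iff_le_exp (by simpa using ha), WithZero.exp_zero]
  constructor
  · intro h
    exact IsDedekindDomain.HeightOneSpectrum.valuation_le_one _ (⟨a, h⟩ : P.ring)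
  · intro h
    obtain ⟨b, rfl⟩ := IsDiscreteValuationRing.exists_lift_of_le_one h
    exact b.2

theorem card_residueField [Finite F] (hd : P.residueDegree ≠ 0) :
    Nat.card (IsLocalRing.ResidueField P.ring) = Nat.card F ^ P.residueDegree := by
  have : Module.Finite F (IsLocalRing.ResidueField P.ring) :=
    Module.finite_of_finrank_pos (Nat.pos_of_ne_zero hd)
  exact Module.natCard_eq_pow_finrank

theorem card_quotient_span [Finite F] (hd : P.residueDegree ≠ 0) (a : P.ring) (ha : a ≠ 0) :
    Nat.card (P.ring ⧸ Ideal.span {a}) = Nat.card F ^ (P.residueDegree * (P.ord a).toNat) := by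
  obtain ⟨ϖ, hϖ⟩ := IsDiscreteValuationRing.exists_irreducible P.ring
  obtain ⟨n, w, rfl⟩ := IsDiscreteValuationRing.eq_unit_mul_pow_irreducible ha hϖ
  have hmax : IsLocalRing.maximalIdeal P.ring ≠ ⊥ := IsDiscreteValuationRing.not_a_field P.ring
  have hspan : Ideal.span {(w : P.ring) * ϖ ^ n} = IsLocalRing.maximalIdeal P.ring ^ n := by
    rw [Ideal.span_singleton_mul_left_unit w.isUnit, hϖ.maximalIdeal_eq, Ideal.span_singleton_pow]
  have hord : P.ord ((w : P.ring) * ϖ ^ n : P.ring) = n := by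
    have hw : (IsDiscreteValuationRing.maximalIdeal P.ring).intValuation (w : P.ring) = 1 := by
      simp [IsDiscreteValuationRing.maximalIdeal]
    have hp := (IsDiscreteValuationRing.maximalIdeal P.ring).intValuation_singleton hϖ.ne_zero
      hϖ.maximalIdeal_eq
    have := (IsDiscreteValuationRing.maximalIdeal P.ring).valuation_of_algebraMap (K := K)
      ((w : P.ring) * ϖ ^ n)
    rw [map_mul _ (w : P.ring), map_pow, hw, hp, one_mul, ← WithZero.exp_nsmul] at this
    rw [ord]
    refine (congrArg (fun z => -WithZero.log z) this).trans ?_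
    simp
  have h := cardQuot_pow_of_prime (P := IsLocalRing.maximalIdeal P.ring) hmax (i := n)
  rw [Submodule.cardQuot_apply, Submodule.cardQuot_apply] at h
  rw [hspan, hord, h, Int.toNat_natCast, pow_mul, ← P.card_residueField hd]
  rfl

section Pole

variable {P} {c : K}

theorem ne_zero_of_ord_neg (hc : P.ord c < 0) : c ≠ 0 := by
  rintro rfl
  simp [ord] at hc

theorem inv_mem_ring (hc : P.ord c < 0) : c⁻¹ ∈ P.ring := by
  rw [P.mem_ring_iff_ord (inv_ne_zero (ne_zero_of_ord_neg hc)), ord_inv]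
  omega

theorem relIndex_poleFiltration [Finite F] (hd : P.residueDegree ≠ 0) (hc : P.ord c < 0) :
    (poleFiltration P.ring c (-1)).relIndex (poleFiltration P.ring c (-1 + 1)) =
      Nat.card F ^ (P.residueDegree * (-P.ord c).toNat) := by
  have hc0 := ne_zero_of_ord_neg hc
  let u : P.ring := ⟨c⁻¹, inv_mem_ring hc⟩
  have hu : u ≠ 0 := fun h => inv_ne_zero hc0 (congrArg Subtype.val h)
  have h1 := P.card_quotient_span hd u hu
  have h2 := card_quotient_span_singleton P.ring.toSubring u (inv_ne_zero hc0)
  have h3 : Nat.card (P.ring ⧸ Ideal.span {u}) =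
      (scale (c⁻¹ : K) P.ring.toSubring.toAddSubgroup).relIndex P.ring.toSubring.toAddSubgroup := h2
  rw [h1] at h3
  have h4 : poleFiltration P.ring c (-1 + 1) = P.ring.toSubring.toAddSubgroup := by
    ext x
    rw [mem_poleFiltration]
    simp
  have h5 : poleFiltration P.ring c (-1) = scale (c⁻¹ : K) P.ring.toSubring.toAddSubgroup := by
    rw [poleFiltration, zpow_neg_one]
  rw [h4, h5, ← h3]
  change Nat.card F ^ (P.residueDegree * (P.ord c⁻¹).toNat) = _
  rw [ord_inv]

theorem eq_zero_of_mem_poleFiltration (hc : P.ord c < 0) {x : K} (hx : x ≠ 0 → P.ord x ≤ 0)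
    (h : x ∈ poleFiltration P.ring c (-1)) : x = 0 := by
  by_contra hx0
  have hc0 := ne_zero_of_ord_neg hc
  rw [mem_poleFiltration, neg_neg, zpow_one, P.mem_ring_iff_ord (mul_ne_zero hc0 hx0),
    P.ord_mul hc0 hx0] at h
  have := hx hx0
  omega

theorem exists_mem_poleFiltration (hc : P.ord c < 0) (x : K) :
    ∃ n : ℕ, x ∈ poleFiltration P.ring c n := by
  have hc0 := ne_zero_of_ord_neg hc
  by_cases hx : x = 0
  · exact ⟨0, hx ▸ AddSubgroup.zero_mem _⟩
  refine ⟨(-P.ord x).toNat, ?_⟩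
  rw [mem_poleFiltration, P.mem_ring_iff_ord (mul_ne_zero (zpow_ne_zero _ hc0) hx),
    P.ord_mul (zpow_ne_zero _ hc0) hx, ord_zpow]
  have h1 : -P.ord x ≤ ((-P.ord x).toNat : ℤ) := Int.self_le_toNat _
  have h2 : ((-P.ord x).toNat : ℤ) * 1 ≤ ((-P.ord x).toNat : ℤ) * -P.ord c :=
    mul_le_mul_of_nonneg_left (by omega) (by positivity)
  linarith

theorem transcendental_of_ord_neg (hc : P.ord c < 0) : Transcendental F c := by
  intro halg
  have hint : IsIntegral P.ring c :=
    (halg.isIntegral).map_of_comp_eq (algebraMap F P.ring) (RingHom.id K) rfl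
  obtain ⟨y, hy⟩ := (IsIntegrallyClosed.isIntegral_iff (R := P.ring) (K := K)).1 hint
  have : c ∈ P.ring := hy ▸ y.2
  rw [P.mem_ring_iff_ord (ne_zero_of_ord_neg hc)] at this
  omega

theorem mem_affineRing_of_isIntegral {x : K} (hx : IsIntegral P.affineRing x) :
    x ∈ P.affineRing := by
  intro Q hQ
  have hint : IsIntegral Q.ring x :=
    hx.map_of_comp_eq
      ({ toFun := fun a => ⟨a, a.2 Q hQ⟩
         map_one' := rfl
         map_mul' := fun _ _ => rfl
         map_zero' := rfl
         map_add' := fun _ _ => rfl } : P.affineRing →+* Q.ring) (RingHom.id K) rfl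
  obtain ⟨y, hy⟩ := (IsIntegrallyClosed.isIntegral_iff (R := Q.ring) (K := K)).1 hint
  exact hy ▸ y.2

/-- Modulo the maximal ideal at `P`, a monic polynomial in `c` is its leading term. -/
theorem one_sub_inv_pow_mul_aeval_mem (hc : P.ord c < 0) {p : F[X]} (hp : p.Monic) :
    1 - c⁻¹ ^ p.natDegree * Polynomial.aeval c p ∈ poleFiltration P.ring c (-1) := by
  have hc0 := ne_zero_of_ord_neg hc
  have h1 : 1 - c⁻¹ ^ p.natDegree * Polynomial.aeval c p = -∑ i ∈ Finset.range p.natDegree,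
      c⁻¹ ^ p.natDegree * (algebraMap F K (p.coeff i) * c ^ i) := by
    rw [Polynomial.aeval_eq_sum_range, Finset.sum_range_succ, hp.coeff_natDegree, one_smul,
      mul_add, ← mul_pow, inv_mul_cancel₀ hc0, one_pow, Finset.mul_sum]
    simp only [Algebra.smul_def]
    ring
  rw [h1]
  refine AddSubgroup.neg_mem _ (AddSubgroup.sum_mem _ fun i hi => ?_)
  obtain ⟨k, hk⟩ := Nat.exists_eq_add_of_lt (Finset.mem_range.1 hi)
  rw [mem_poleFiltration, neg_neg, zpow_one, hk]
  have : c * (c⁻¹ ^ (i + k + 1) * (algebraMap F K (p.coeff i) * c ^ i)) =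
      algebraMap F K (p.coeff i) * c⁻¹ ^ k := by
    rw [pow_succ, pow_add]
    have h2 : c⁻¹ ^ i * c ^ i = 1 := by rw [← mul_pow, inv_mul_cancel₀ hc0, one_pow]
    calc _ = algebraMap F K (p.coeff i) * c⁻¹ ^ k * (c⁻¹ ^ i * c ^ i) * (c * c⁻¹) := by ring
      _ = _ := by rw [h2, mul_inv_cancel₀ hc0, mul_one, mul_one]
  rw [this]
  exact mul_mem (P.algebraMap_mem _) (pow_mem (inv_mem_ring hc) k)

variable [Algebra F⟮X⟯ K] [IsScalarTower F F⟮X⟯ K] [FunctionField F K]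

/-- `K` is finite over `F(c)` because `c` is transcendental, so some nonzero multiple `p(c) y` is
integral over `F[c] ⊆ A`, and `A` is integrally closed in `K`. -/
theorem exists_monic_aeval_mul_mem_affineRing (hc : P.ord c < 0) (hcA : c ∈ P.affineRing) (y : K) :
    ∃ p : F[X], p.Monic ∧ Polynomial.aeval c p * y ∈ P.affineRing := by
  have htr := transcendental_of_ord_neg hc
  have := FunctionField.finiteDimensional_of_adjoin_transcendental htr
  have halg : IsAlgebraic (Algebra.adjoin F {c}) y :=
    IntermediateField.isAlgebraic_adjoin_iff.1
      (Algebra.IsAlgebraic.isAlgebraic (R := IntermediateField.adjoin F {c}) y)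
  obtain ⟨r, hr0, hr⟩ := halg.exists_integral_multiple
  have hle : Algebra.adjoin F {c} ≤ P.affineRing := Algebra.adjoin_le (by simpa using hcA)
  have hmem : (r : K) * y ∈ P.affineRing :=
    mem_affineRing_of_isIntegral
      (hr.map_of_comp_eq (Subalgebra.inclusion hle).toRingHom (RingHom.id K) rfl)
  obtain ⟨p, hp⟩ := (Algebra.adjoin_singleton_eq_range_aeval F c).le r.2
  have hp0 : p ≠ 0 := by
    rintro rfl
    refine hr0 (Subtype.ext ?_)
    rw [← hp]
    simp
  refine ⟨p * Polynomial.C p.leadingCoeff⁻¹, Polynomial.monic_mul_leadingCoeff_inv hp0, ?_⟩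
  rw [map_mul, Polynomial.aeval_C, mul_right_comm]
  refine P.affineRing.mul_mem ?_ (P.affineRing.algebraMap_mem _)
  rw [← hp] at hmem
  exact hmem

/-- If `p` is monic of degree `n` with `p(c) y ∈ A`, then `c⁻ⁿ p(c)` is `1` modulo `c⁻¹ O`, so `a =
p(c) y` works. -/
theorem approx_affineRing (hc : P.ord c < 0) (hcA : c ∈ P.affineRing) {y : K} (hy : y ∈ P.ring) :
    ∃ n : ℕ, ∃ a ∈ P.affineRing.toSubring, y - c⁻¹ ^ n * a ∈ poleFiltration P.ring c (-1) := by
  obtain ⟨p, hp, hpy⟩ := exists_monic_aeval_mul_mem_affineRing hc hcA y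
  refine ⟨p.natDegree, _, hpy, ?_⟩
  have h := mem_poleFiltration.1 (one_sub_inv_pow_mul_aeval_mem hc hp)
  rw [mem_poleFiltration]
  have h2 := mul_mem h hy
  convert h2 using 1
  ring

theorem isFractionRing_affineRing (hc : P.ord c < 0) (hcA : c ∈ P.affineRing) :
    IsFractionRing P.affineRing K := by
  have : FaithfulSMul P.affineRing K :=
    (faithfulSMul_iff_algebraMap_injective _ _).2 Subtype.val_injective
  refine IsFractionRing.of_field _ _ fun y => ?_
  obtain ⟨p, hp, hpy⟩ := exists_monic_aeval_mul_mem_affineRing hc hcA y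
  have hpA : Polynomial.aeval c p ∈ P.affineRing := by
    have : Algebra.adjoin F {c} ≤ P.affineRing := Algebra.adjoin_le (by simpa using hcA)
    exact this (Polynomial.aeval_mem_adjoin_singleton F c)
  refine ⟨⟨_, hpy⟩, ⟨_, hpA⟩, ?_⟩
  have h0 : Polynomial.aeval c p ≠ 0 := fun h =>
    hp.ne_zero ((transcendental_iff.1 (transcendental_of_ord_neg hc)) p h)
  change y = Polynomial.aeval c p * y / Polynomial.aeval c p
  rw [mul_div_cancel_left₀ _ h0]

variable [Finite F]

theorem card_affineRing_quotient (hd : P.residueDegree ≠ 0)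
    (hA : ∀ a ∈ P.affineRing, a ≠ 0 → P.ord a ≤ 0) {c : P.affineRing} (hc : P.ord (c : K) < 0) :
    Finite (P.affineRing ⧸ Ideal.span {c}) ∧
      Nat.card F ^ (P.residueDegree * (-P.ord (c : K)).toNat) ≤
        Nat.card (P.affineRing ⧸ Ideal.span {c}) := by
  have hc0 := ne_zero_of_ord_neg hc
  have hB : (poleFiltration P.ring (c : K) (-1)).relIndex (poleFiltration P.ring c (-1 + 1)) ≠ 0 := by
    rw [relIndex_poleFiltration hd hc]
    exact pow_ne_zero _ Nat.card_pos.ne'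
  have h0 : ∀ x ∈ P.affineRing.toSubring, x ∈ poleFiltration P.ring (c : K) (-1) → x = 0 :=
    fun x hx => eq_zero_of_mem_poleFiltration hc (hA x hx)
  have hcard : Nat.card (P.affineRing ⧸ Ideal.span {c}) = _ :=
    card_quotient_span_singleton P.affineRing.toSubring c hc0
  constructor
  · refine Nat.finite_of_card_ne_zero ?_
    rw [hcard]
    exact relIndex_scale_ne_zero hc0 c.2 (inv_mem_ring hc) hB h0 (exists_mem_poleFiltration hc)
  · rw [hcard, ← relIndex_poleFiltration hd hc]
    exact relIndex_poleFiltration_le hc0 c.2 (inv_mem_ring hc) hB h0 (exists_mem_poleFiltration hc)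
      fun y hy => approx_affineRing hc c.2 hy

theorem mem_affineRing_of_ord_nonpos (hd : P.residueDegree ≠ 0) {c : P.affineRing}
    (hc : P.ord (c : K) < 0) {R : Subring K} (hAR : P.affineRing.toSubring ≤ R)
    (hR : ∀ a ∈ R, a ≠ 0 → P.ord a ≤ 0) {t : K} (ht : t ∈ R) : t ∈ P.affineRing := by
  have hc0 := ne_zero_of_ord_neg hc
  have hB : (poleFiltration P.ring (c : K) (-1)).relIndex (poleFiltration P.ring c (-1 + 1)) ≠ 0 := by
    rw [relIndex_poleFiltration hd hc]
    exact pow_ne_zero _ Nat.card_pos.ne'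
  exact mem_affineRing_of_isIntegral (isIntegral_of_ne_zero hAR hc0 c.2 (inv_mem_ring hc) hB
    (fun x hx => eq_zero_of_mem_poleFiltration hc (hR x hx)) (exists_mem_poleFiltration hc) ht)

/-- Finite quotients give the Noetherian property and dimension at most one. A nonzero `a` in an
ideal is replaced by `a * c`, which certainly has a pole at `P`. -/
theorem isDedekindDomain_affineRing (hd : P.residueDegree ≠ 0)
    (hA : ∀ a ∈ P.affineRing, a ≠ 0 → P.ord a ≤ 0) {c : P.affineRing} (hc : P.ord (c : K) < 0) :
    IsDedekindDomain P.affineRing := by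
  have hquot : Ring.HasFiniteQuotients P.affineRing := by
    refine ⟨fun {I} hI => ?_⟩
    obtain ⟨a, haI, ha0⟩ := Submodule.exists_mem_ne_zero_of_ne_bot hI
    have ha0' : (a : K) ≠ 0 := fun h => ha0 (Subtype.ext h)
    have hac : P.ord ((a * c : P.affineRing) : K) < 0 := by
      have h1 : P.ord ((a * c : P.affineRing) : K) = P.ord (a : K) + P.ord (c : K) :=
        P.ord_mul ha0' (ne_zero_of_ord_neg hc)
      have := hA a a.2 ha0'
      omega
    have := (card_affineRing_quotient hd hA hac).1
    have hle : Ideal.span {a * c} ≤ I := by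
      rw [Ideal.span_singleton_le_iff_mem]
      exact I.mul_mem_right c haI
    exact Finite.of_surjective _ (Ideal.Quotient.factor_surjective hle)
  have := isFractionRing_affineRing hc c.2
  have : IsIntegrallyClosed P.affineRing := (isIntegrallyClosed_iff K).2 fun {x} hx =>
    ⟨⟨x, mem_affineRing_of_isIntegral hx⟩, rfl⟩
  exact { }

end Pole

end Place

/-! ### Torsion of a homomorphism to twisted polynomials. -/

section Torsion

variable {F : Type*} [Field F] [Fintype F] {E : Type*} [Field E] [Algebra F E]
  {A : Type*} [CommRing A] {Ω : Type*} [Field Ω] [Algebra E Ω]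

theorem mul_comm_eval (ρ : A →+* TwistedPoly F E) (a b : A) (u : Ω) :
    (ρ a).eval ((ρ b).eval u) = (ρ b).eval ((ρ a).eval u) := by
  rw [← TwistedPoly.mul_eval, ← TwistedPoly.mul_eval, ← map_mul, ← map_mul, mul_comm]

theorem eval_eq_zero_of_dvd (ρ : A →+* TwistedPoly F E) {a b : A} (h : a ∣ b) {u : Ω}
    (hu : (ρ a).eval u = 0) : (ρ b).eval u = 0 := by
  obtain ⟨k, rfl⟩ := h
  rw [mul_comm, map_mul, TwistedPoly.mul_eval, hu, TwistedPoly.eval_zero]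

/-- Torsion points of bounded degree over `F(X)` are finite in number. -/
theorem finite_torsion [Algebra F⟮X⟯ Ω] [Algebra.IsAlgebraic F⟮X⟯ Ω] (ρ : A →+* TwistedPoly F E)
    (hρ : ∀ a, a ≠ 0 → ρ a ≠ 0) {a₀ : A} (ha₀ : 0 < (ρ a₀).degree) (L : IntermediateField E Ω)
    (D : ℕ) (hD : ∀ u ∈ L, (minpoly F⟮X⟯ u).natDegree ≤ D) : (torsion ρ L).Finite := by
  have hne : ρ a₀ ≠ 0 := by
    intro h
    have : (ρ a₀).degree ≤ 0 := TwistedPoly.degree_le fun k _ => by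
      rw [h, TwistedPoly.coeff_zero]
    omega
  have hdeg : 2 ≤ ((ρ a₀).toPolynomial Ω).natDegree := by
    rw [TwistedPoly.toPolynomial_natDegree hne]
    exact (Fintype.one_lt_card (α := F)).trans_le (Nat.le_self_pow ha₀.ne' _)
  refine (finite_preperiodic (F := F) hdeg D).subset ?_
  rintro u ⟨huL, a, ha, hau⟩
  -- The kernel of `ρ_a` is stable under `ρ_{a₀}` because the two commute, so it contains the whole
  -- orbit of `u`.
  refine ⟨hD u huL, (TwistedPoly.finite_kernel (Ω := Ω) (hρ a ha)).subset ?_⟩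
  rintro _ ⟨n, rfl⟩
  change (ρ a).eval _ = 0
  induction n with
  | zero => exact hau
  | succ n ih =>
    dsimp only at ih ⊢
    rw [Function.iterate_succ_apply', TwistedPoly.toPolynomial_eval, mul_comm_eval, ih,
      TwistedPoly.eval_zero]

/-- A finite torsion module `μ_ρ(L)` is of the form `ρ[b]`, provided that `ρ[c]` has at most as many
elements as `A / c` and `c` divides `a` whenever `ρ_c` divides `ρ_a` on the right. -/
theorem torsion_eq_idealTorsion [IsDedekindDomain A] [IsAlgClosed Ω] (ρ : A →+* TwistedPoly F E)
    (L : IntermediateField E Ω) (hcoeff : ∀ c, c ≠ 0 → (ρ c).coeff 0 ≠ 0) {c₀ : A} (hc₀ : c₀ ≠ 0)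
    (hquot : ∀ a, a ≠ 0 → Finite (A ⧸ Ideal.span {a * c₀}) ∧
      Fintype.card F ^ (ρ (a * c₀)).degree ≤ Nat.card (A ⧸ Ideal.span {a * c₀}))
    (hdvd : ∀ a c g, c ≠ 0 → ρ a = g * ρ c → c ∣ a) (hfin : (torsion ρ L).Finite) :
    ∃ b : Ideal A, b ≠ ⊥ ∧ torsion ρ L = idealTorsion Ω ρ b := by
  let _ : Module A Ω := Module.compHom Ω ((TwistedPoly.evalHom F E Ω).comp ρ)
  have hsmul : ∀ (a : A) (u : Ω), a • u = (ρ a).eval u := fun _ _ => rfl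
  let M : Submodule A Ω :=
    { carrier := torsion ρ L
      zero_mem' := ⟨L.zero_mem, 1, one_ne_zero, TwistedPoly.eval_zero _⟩
      add_mem' := by
        rintro u v ⟨hu, a, ha, hau⟩ ⟨hv, b, hb, hbv⟩
        refine ⟨L.add_mem hu hv, a * b, mul_ne_zero ha hb, ?_⟩
        rw [TwistedPoly.eval_add, eval_eq_zero_of_dvd ρ (Dvd.intro b rfl) hau,
          eval_eq_zero_of_dvd ρ (Dvd.intro_left a rfl) hbv, add_zero]
      smul_mem' := by
        rintro x u ⟨hu, a, ha, hau⟩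
        refine ⟨TwistedPoly.eval_mem hu, a, ha, ?_⟩
        rw [hsmul, mul_comm_eval, hau, TwistedPoly.eval_zero] }
  have hM : ∀ u, u ∈ M ↔ u ∈ torsion ρ L := fun u => Iff.rfl
  have hann : ∀ u : Ω, ∃ a : A, a ≠ 0 ∧ (u ∈ torsion ρ L → (ρ a).eval u = 0) := by
    intro u
    by_cases hu : u ∈ torsion ρ L
    · obtain ⟨-, a, ha, hau⟩ := hu
      exact ⟨a, ha, fun _ => hau⟩
    · exact ⟨1, one_ne_zero, fun h => absurd h hu⟩
  choose a ha hau using hann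
  -- The product kills the finite torsion; the factor `c₀` puts `c` in the form for which `hquot`
  -- counts `A / c`.
  set c := (∏ u ∈ hfin.toFinset, a u) * c₀
  have hprod : ∏ u ∈ hfin.toFinset, a u ≠ 0 := Finset.prod_ne_zero_iff.2 fun u _ => ha u
  have hc : c ≠ 0 := mul_ne_zero hprod hc₀
  have hkill : ∀ u ∈ M, c • u = 0 := fun u hu =>
    eval_eq_zero_of_dvd ρ
      ((Finset.dvd_prod_of_mem a (hfin.mem_toFinset.2 hu)).mul_right c₀) (hau u hu)
  have hne : ρ c ≠ 0 := fun h => hcoeff c hc (by rw [h, TwistedPoly.coeff_zero])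
  obtain ⟨hfinite, hcard⟩ := hquot _ hprod
  obtain ⟨b, hb0, hb⟩ := exists_forall_mem_iff_smul_eq_zero (N := Ω) hc
    ((TwistedPoly.ncard_kernel_le hne).trans hcard) (TwistedPoly.finite_kernel hne)
    (fun x hx => by
      obtain ⟨g, hg⟩ := TwistedPoly.exists_eq_mul_of_kernel_le (Ω := Ω) (f := ρ x) (hcoeff c hc) hx
      exact hdvd x c g hc hg) M hkill
  exact ⟨b, hb0, Set.ext fun u => (hM u).symm.trans (hb u)⟩

end Torsion

/-! ### Consequences of rank one. -/

section RankOne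

variable {F : Type*} [Field F] [Fintype F] {K : Type*} [Field K] [Algebra F K]
  {P : Place F K} {E : Type*} [Field E] [Algebra F E] [Algebra K E] (ρ : DrinfeldModule P E)

namespace DrinfeldModule

theorem coeff_zero_ne_zero {a : P.affineRing} (ha : a ≠ 0) : (ρ.hom a).coeff 0 ≠ 0 := by
  rw [ρ.coeff_zero, map_ne_zero]
  exact fun h => ha (Subtype.ext h)

theorem hom_ne_zero {a : P.affineRing} (ha : a ≠ 0) : ρ.hom a ≠ 0 := fun h =>
  ρ.coeff_zero_ne_zero ha (by rw [h, TwistedPoly.coeff_zero])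

theorem exists_degree_pos : ∃ a : P.affineRing, a ≠ 0 ∧ 0 < (ρ.hom a).degree := by
  obtain ⟨a, ha⟩ := ρ.nontrivial
  refine ⟨a, ?_, Nat.pos_of_ne_zero fun h => ha (TwistedPoly.ext fun n => ?_)⟩
  · rintro rfl
    exact ha (by simp)
  · rw [← TwistedPoly.monomial_zero_eq_C, TwistedPoly.coeff_monomial]
    split_ifs with hn
    · rw [← hn, ρ.coeff_zero]
    · exact TwistedPoly.coeff_eq_zero_of_degree_lt (by omega)

variable {ρ}

theorem HasRank.degree_eq (hρ : ρ.HasRank 1) {a : P.affineRing} (ha : a ≠ 0) :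
    ((ρ.hom a).degree : ℤ) = P.residueDegree * -P.ord (a : K) := by
  rw [hρ a ha, Place.deg, Nat.cast_one, one_mul, mul_neg]

/-- `finrank` is `0` for an infinite residue extension; the rank formula would then make every `ρ_a`
constant. -/
theorem HasRank.residueDegree_ne_zero (hρ : ρ.HasRank 1) : P.residueDegree ≠ 0 := by
  intro h
  obtain ⟨a, ha, hdeg⟩ := ρ.exists_degree_pos
  have := hρ.degree_eq ha
  rw [h, Nat.cast_zero, zero_mul] at this
  omega

theorem HasRank.ord_nonpos (hρ : ρ.HasRank 1) {a : P.affineRing} (ha : a ≠ 0) :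
    P.ord (a : K) ≤ 0 := by
  by_contra h
  have h1 : (0 : ℤ) < P.residueDegree := by
    exact_mod_cast Nat.pos_of_ne_zero hρ.residueDegree_ne_zero
  have h2 := mul_pos h1 (not_le.1 h)
  have h3 := hρ.degree_eq ha
  rw [mul_neg] at h3
  omega

theorem HasRank.exists_ord_neg (hρ : ρ.HasRank 1) :
    ∃ a : P.affineRing, 0 < (ρ.hom a).degree ∧ P.ord (a : K) < 0 := by
  obtain ⟨a, ha, hdeg⟩ := ρ.exists_degree_pos
  refine ⟨a, hdeg, (hρ.ord_nonpos ha).lt_of_ne fun h => ?_⟩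
  have := hρ.degree_eq ha
  rw [h, neg_zero, mul_zero] at this
  omega

variable (ρ) in
/-- The ring of all quotients `a / c` such that `ρ_c` divides `ρ_a` on the right. -/
def quotientRing : Subring K where
  carrier := {t | ∃ c a : P.affineRing, ∃ g, c ≠ 0 ∧ t * c = a ∧ ρ.hom a = g * ρ.hom c}
  one_mem' := ⟨1, 1, 1, one_ne_zero, one_mul _, by simp⟩
  zero_mem' := ⟨1, 0, 0, one_ne_zero, zero_mul _, by simp⟩
  mul_mem' := by
    rintro s t ⟨c, a, g, hc, hs, hg⟩ ⟨d, b, h, hd, ht, hh⟩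
    refine ⟨c * d, a * b, g * h, mul_ne_zero hc hd, ?_, ?_⟩
    · push_cast
      rw [← hs, ← ht]
      ring
    · calc ρ.hom (a * b) = g * ρ.hom (c * b) := by rw [map_mul, map_mul, hg, mul_assoc]
        _ = g * (h * ρ.hom d * ρ.hom c) := by rw [mul_comm c b, map_mul, hh]
        _ = g * h * ρ.hom (c * d) := by rw [mul_comm c d, map_mul, mul_assoc, mul_assoc]
  add_mem' := by
    rintro s t ⟨c, a, g, hc, hs, hg⟩ ⟨d, b, h, hd, ht, hh⟩
    refine ⟨c * d, a * d + b * c, g + h, mul_ne_zero hc hd, ?_, ?_⟩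
    · push_cast
      rw [← hs, ← ht]
      ring
    · rw [map_add, map_mul, map_mul, add_mul, hg, hh, mul_assoc, mul_assoc, ← map_mul, ← map_mul,
        mul_comm d c]
  neg_mem' := by
    rintro t ⟨c, a, g, hc, ht, hg⟩
    refine ⟨c, -a, -g, hc, ?_, ?_⟩
    · push_cast
      rw [← ht, neg_mul]
    · rw [map_neg, hg, neg_mul]

/-- If `t = a / c` and `ρ_a = g ρ_c`, then `deg t = deg_τ g ≥ 0`. -/
theorem HasRank.ord_nonpos_of_mem_quotientRing (hρ : ρ.HasRank 1) {t : K}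
    (ht : t ∈ ρ.quotientRing) (ht0 : t ≠ 0) : P.ord t ≤ 0 := by
  obtain ⟨c, a, g, hc, hta, hg⟩ := ht
  have hc' : (c : K) ≠ 0 := fun h => hc (Subtype.ext h)
  have ha : a ≠ 0 := by
    rintro rfl
    exact mul_ne_zero ht0 hc' hta
  have hg0 : g ≠ 0 := by
    rintro rfl
    exact ρ.hom_ne_zero ha (by rw [hg, zero_mul])
  have h1 := TwistedPoly.degree_mul hg0 (ρ.hom_ne_zero hc)
  rw [← hg] at h1
  have h2 := hρ.degree_eq ha
  have h3 := hρ.degree_eq hc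
  have h4 := P.ord_mul ht0 hc'
  rw [hta] at h4
  by_contra h
  have h5 : (0 : ℤ) < P.residueDegree := by
    exact_mod_cast Nat.pos_of_ne_zero hρ.residueDegree_ne_zero
  have h6 := mul_pos h5 (not_le.1 h)
  rw [h1, h4, Nat.cast_add, h3] at h2
  have h7 : (g.degree : ℤ) = -(P.residueDegree * P.ord t) := by linarith
  omega

variable [Algebra F⟮X⟯ K] [IsScalarTower F F⟮X⟯ K] [FunctionField F K]

/-- `quotientRing` contains `A` and none of its nonzero elements vanishes at `P`, so it is integral
over `A` and equals `A`; it contains `a / c`. -/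
theorem HasRank.dvd_of_hom_eq_mul (hρ : ρ.HasRank 1) {a c : P.affineRing} {g : TwistedPoly F E}
    (hc : c ≠ 0) (h : ρ.hom a = g * ρ.hom c) : c ∣ a := by
  have hc' : (c : K) ≠ 0 := fun h => hc (Subtype.ext h)
  obtain ⟨c₀, -, hc₀⟩ := hρ.exists_ord_neg
  have hle : P.affineRing.toSubring ≤ ρ.quotientRing := fun x hx =>
    ⟨1, ⟨x, hx⟩, ρ.hom ⟨x, hx⟩, one_ne_zero, mul_one _, by simp⟩
  have hmem : (a : K) / c ∈ P.affineRing :=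
    Place.mem_affineRing_of_ord_nonpos hρ.residueDegree_ne_zero hc₀ hle
      (fun _ => hρ.ord_nonpos_of_mem_quotientRing) ⟨c, a, g, hc, div_mul_cancel₀ _ hc', h⟩
  exact ⟨⟨_, hmem⟩, Subtype.ext (mul_div_cancel₀ _ hc').symm⟩

theorem HasRank.isDedekindDomain (hρ : ρ.HasRank 1) : IsDedekindDomain P.affineRing := by
  obtain ⟨c₀, -, hc₀⟩ := hρ.exists_ord_neg
  exact Place.isDedekindDomain_affineRing hρ.residueDegree_ne_zero
    (fun a ha h => hρ.ord_nonpos (a := ⟨a, ha⟩) fun h' => h (congrArg Subtype.val h')) hc₀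

theorem HasRank.card_quotient (hρ : ρ.HasRank 1) {c : P.affineRing} (hc : P.ord (c : K) < 0) :
    Finite (P.affineRing ⧸ Ideal.span {c}) ∧
      Fintype.card F ^ (ρ.hom c).degree ≤ Nat.card (P.affineRing ⧸ Ideal.span {c}) := by
  have h := Place.card_affineRing_quotient hρ.residueDegree_ne_zero
    (fun a ha h => hρ.ord_nonpos (a := ⟨a, ha⟩) fun h' => h (congrArg Subtype.val h')) hc
  refine ⟨h.1, ?_⟩
  have hc0 : c ≠ 0 := fun h => Place.ne_zero_of_ord_neg hc (congrArg Subtype.val h)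
  have hdeg : (ρ.hom c).degree = P.residueDegree * (-P.ord (c : K)).toNat := by
    zify
    rw [hρ.degree_eq hc0, Int.toNat_of_nonneg (by omega)]
  rw [hdeg, ← Nat.card_eq_fintype_card]
  exact h.2

/-- The torsion of a Drinfeld module of rank one over a finite extension is an ideal torsion. -/
theorem HasRank.torsion_eq (hρ : ρ.HasRank 1) {Ω : Type*} [Field Ω] [Algebra E Ω] [IsAlgClosed Ω]
    (L : IntermediateField E Ω) (hfin : (torsion ρ.hom L).Finite) :
    ∃ b : Ideal P.affineRing, b ≠ ⊥ ∧ torsion ρ.hom L = idealTorsion Ω ρ.hom b := by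
  have := hρ.isDedekindDomain
  obtain ⟨c₀, -, hc₀⟩ := hρ.exists_ord_neg
  have hc₀' : c₀ ≠ 0 := fun h => Place.ne_zero_of_ord_neg hc₀ (congrArg Subtype.val h)
  refine torsion_eq_idealTorsion ρ.hom L (fun c hc => ρ.coeff_zero_ne_zero hc) hc₀'
    (fun a ha => hρ.card_quotient ?_) (fun a c g hc h => hρ.dvd_of_hom_eq_mul hc h) hfin
  have h1 : P.ord ((a * c₀ : P.affineRing) : K) = P.ord (a : K) + P.ord (c₀ : K) :=
    P.ord_mul (fun h => ha (Subtype.ext h)) (Place.ne_zero_of_ord_neg hc₀)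
  have := hρ.ord_nonpos ha
  omega

end DrinfeldModule

end RankOne

/-! ### The Carlitz module. -/

section Carlitz

variable (F : Type*) [Field F] [Fintype F]

theorem carlitz_C (a : F) : carlitz F (Polynomial.C a) =
    TwistedPoly.C F F⟮X⟯ (algebraMap F F⟮X⟯ a) := by
  simp [carlitz]

theorem carlitz_X : carlitz F Polynomial.X =
    TwistedPoly.C F F⟮X⟯ RatFunc.X + TwistedPoly.τ F F⟮X⟯ := by
  simp [carlitz]

theorem coeff_zero_carlitz (p : F[X]) :
    (carlitz F p).coeff 0 = algebraMap F[X] F⟮X⟯ p := by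
  induction p using Polynomial.induction_on' with
  | add p q hp hq => rw [map_add, TwistedPoly.coeff_add, hp, hq, map_add]
  | monomial n a =>
    induction n with
    | zero =>
      rw [Polynomial.monomial_zero_left, carlitz_C, ← TwistedPoly.monomial_zero_eq_C,
        TwistedPoly.coeff_monomial, if_pos rfl]
      simp
    | succ n ih =>
      rw [← Polynomial.monomial_mul_X, map_mul, TwistedPoly.coeff_mul, map_mul, ← ih, carlitz_X,
        ← TwistedPoly.monomial_zero_eq_C, ← TwistedPoly.monomial_one_one_eq_τ]
      simp [TwistedPoly.coeff_add, TwistedPoly.coeff_monomial]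

theorem carlitz_ne_zero {p : F[X]} (hp : p ≠ 0) : carlitz F p ≠ 0 := by
  intro h
  have := coeff_zero_carlitz F p
  rw [h, TwistedPoly.coeff_zero] at this
  exact hp ((map_eq_zero_iff _ (IsFractionRing.injective F[X] F⟮X⟯)).1 this.symm)

theorem degree_carlitz_X : (carlitz F Polynomial.X).degree = 1 := by
  rw [carlitz_X, ← TwistedPoly.monomial_zero_eq_C, ← TwistedPoly.monomial_one_one_eq_τ]
  refine le_antisymm (TwistedPoly.degree_le fun k hk => ?_) (TwistedPoly.le_degree ?_)
  · rw [TwistedPoly.coeff_add, TwistedPoly.coeff_monomial, TwistedPoly.coeff_monomial,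
      if_neg (by omega), if_neg (by omega), add_zero]
  · rw [TwistedPoly.coeff_add, TwistedPoly.coeff_monomial, TwistedPoly.coeff_monomial,
      if_neg (by omega), if_pos rfl, zero_add]
    exact one_ne_zero

theorem degree_carlitz {p : F[X]} (hp : p ≠ 0) : (carlitz F p).degree = p.natDegree := by
  obtain ⟨n, hn⟩ : ∃ n, p.natDegree = n := ⟨_, rfl⟩
  induction n generalizing p with
  | zero =>
    rw [Polynomial.eq_C_of_natDegree_eq_zero hn] at hp ⊢
    rw [carlitz_C, ← TwistedPoly.monomial_zero_eq_C, TwistedPoly.degree_monomial,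
      Polynomial.natDegree_C]
    simpa using hp
  | succ n ih =>
    have hd : p.divX.natDegree = n := by rw [Polynomial.natDegree_divX_eq_natDegree_tsub_one, hn]; rfl
    have hd0 : p.divX ≠ 0 := by
      rw [Ne, Polynomial.divX_eq_zero_iff]
      intro h
      rw [h, Polynomial.natDegree_C] at hn
      omega
    have hdeg : (carlitz F p.divX * carlitz F Polynomial.X).degree = n + 1 := by
      rw [TwistedPoly.degree_mul (carlitz_ne_zero F hd0) (carlitz_ne_zero F Polynomial.X_ne_zero),
        ih hd0 hd, hd, degree_carlitz_X]
    have hne := TwistedPoly.mul_ne_zero' (carlitz_ne_zero F hd0)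
      (carlitz_ne_zero F Polynomial.X_ne_zero)
    -- Writing `p = p.divX * X + const`, the constant only affects the coefficient of `τ ^ 0`.
    have hcoeff : ∀ k, 0 < k → (carlitz F p).coeff k =
        (carlitz F p.divX * carlitz F Polynomial.X).coeff k := by
      intro k hk
      conv_lhs => rw [← Polynomial.divX_mul_X_add p]
      rw [map_add, map_mul, carlitz_C, ← TwistedPoly.monomial_zero_eq_C, TwistedPoly.coeff_add,
        TwistedPoly.coeff_monomial, if_neg hk.ne, add_zero]
    rw [hn]
    refine le_antisymm (TwistedPoly.degree_le fun k hk => ?_) (TwistedPoly.le_degree ?_)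
    · rw [hcoeff k (by omega)]
      exact TwistedPoly.coeff_eq_zero_of_degree_lt (by omega)
    · rw [hcoeff _ (by omega), ← hdeg]
      exact TwistedPoly.coeff_degree_ne_zero hne

/-- The remainder of `a` modulo `c` also maps to a left multiple of `C_c`, but its degree is too
small unless it vanishes. -/
theorem dvd_of_carlitz_eq_mul {a c : F[X]} {g : TwistedPoly F F⟮X⟯} (hc : c ≠ 0)
    (h : carlitz F a = g * carlitz F c) : c ∣ a := by
  by_contra hdvd
  have hmod : a % c ≠ 0 := fun h0 => hdvd (EuclideanDomain.mod_eq_zero.1 h0)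
  have h1 : carlitz F (a % c) = (g - carlitz F (a / c)) * carlitz F c := by
    rw [EuclideanDomain.mod_eq_sub_mul_div, mul_comm c, map_sub, map_mul, h, sub_mul]
  have h2 : g - carlitz F (a / c) ≠ 0 := by
    intro h0
    rw [h0, zero_mul] at h1
    exact carlitz_ne_zero F hmod h1
  have h3 := TwistedPoly.degree_mul h2 (carlitz_ne_zero F hc)
  rw [← h1, degree_carlitz F hmod, degree_carlitz F hc] at h3
  have h4 := Polynomial.natDegree_lt_natDegree hmod (Polynomial.degree_mod_lt a hc)
  omega

theorem card_quotient_span_polynomial {c : F[X]} (hc : c ≠ 0) :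
    Finite (F[X] ⧸ Ideal.span {c}) ∧
      Nat.card (F[X] ⧸ Ideal.span {c}) = Fintype.card F ^ c.natDegree := by
  have : Module.Finite F (F[X] ⧸ Ideal.span {c}) :=
    (AdjoinRoot.powerBasis hc).finite
  refine ⟨Module.finite_of_finite F, ?_⟩
  rw [Module.natCard_eq_pow_finrank (K := F), finrank_quotient_span_eq_natDegree,
    Nat.card_eq_fintype_card]

theorem exists_torsion_eq_carlitzTorsion {Ω : Type*} [Field Ω] [Algebra F⟮X⟯ Ω] [IsAlgClosed Ω]
    (L : IntermediateField F⟮X⟯ Ω) (hfin : (torsion (carlitz F) L).Finite) :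
    ∃ M : F[X], M ≠ 0 ∧ torsion (carlitz F) L = carlitzTorsion F Ω M := by
  obtain ⟨b, hb0, hb⟩ := torsion_eq_idealTorsion (carlitz F) L
    (fun c hc => by
      rw [coeff_zero_carlitz]
      exact (map_ne_zero_iff _ (IsFractionRing.injective F[X] F⟮X⟯)).2 hc)
    (one_ne_zero (α := F[X]))
    (fun a ha => by
      rw [mul_one, degree_carlitz F ha]
      exact ⟨(card_quotient_span_polynomial F ha).1, (card_quotient_span_polynomial F ha).2.ge⟩)
    (fun a c g hc h => dvd_of_carlitz_eq_mul F hc h) hfin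
  refine ⟨Submodule.IsPrincipal.generator b, ?_, ?_⟩
  · rwa [Ne, ← Submodule.IsPrincipal.eq_bot_iff_generator_eq_zero]
  · rw [hb]
    ext u
    refine ⟨fun h => h _ (Submodule.IsPrincipal.generator_mem b), fun h c hc => ?_⟩
    exact eval_eq_zero_of_dvd (carlitz F)
      ((Submodule.IsPrincipal.mem_iff_generator_dvd b).1 hc) h

end Carlitz

end Drinfeld

end

/-! ### The theorem: elements of `L` have degree at most `[L : F(X)]`, so finiteness applies. -/

theorem mainTheorem12 {F : Type*} [Field F] [Fintype F] :
    (∀ {K : Type*} [Field K] [Algebra F K] [Algebra F⟮X⟯ K] [IsScalarTower F F⟮X⟯ K]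
        [FunctionField F K] (P : Drinfeld.Place F K)
        {Ω : Type*} [Field Ω] [Algebra F Ω] [Algebra K Ω] [IsScalarTower F K Ω]
        [IsAlgClosure K Ω]
        (E : IntermediateField K Ω) [FiniteDimensional K E]
        (ρ : Drinfeld.DrinfeldModule P E), ρ.HasRank 1 →
        ∀ (L : IntermediateField E Ω) [FiniteDimensional E L],
          ∃ b : Ideal P.affineRing, b ≠ ⊥ ∧
            Drinfeld.torsion ρ.hom L = Drinfeld.idealTorsion Ω ρ.hom b) ∧
    (∀ {Ω : Type*} [Field Ω] [Algebra F⟮X⟯ Ω] [IsAlgClosure F⟮X⟯ Ω]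
        (L : IntermediateField F⟮X⟯ Ω) [FiniteDimensional F⟮X⟯ L],
        ∃ M : F[X], M ≠ 0 ∧
          Drinfeld.torsion (Drinfeld.carlitz F) L = Drinfeld.carlitzTorsion F Ω M) := by
  constructor
  · intro K _ _ _ _ _ P Ω _ _ _ _ _ E _ ρ hρ L _
    have : IsAlgClosed Ω := IsAlgClosure.isAlgClosed K
    have : Algebra.IsAlgebraic K Ω := IsAlgClosure.isAlgebraic
    let _ : Algebra F⟮X⟯ Ω := ((algebraMap K Ω).comp (algebraMap F⟮X⟯ K)).toAlgebra
    have : IsScalarTower F⟮X⟯ K Ω := .of_algebraMap_eq fun _ => rfl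
    have : Algebra.IsAlgebraic F⟮X⟯ Ω := Algebra.IsAlgebraic.trans F⟮X⟯ K Ω
    have : FiniteDimensional F⟮X⟯ E := FiniteDimensional.trans F⟮X⟯ K E
    let _ : Algebra F⟮X⟯ L := ((algebraMap E L).comp (algebraMap F⟮X⟯ E)).toAlgebra
    have : IsScalarTower F⟮X⟯ E L := .of_algebraMap_eq fun _ => rfl
    have : IsScalarTower F⟮X⟯ L Ω := .of_algebraMap_eq fun _ => rfl
    have : FiniteDimensional F⟮X⟯ L := FiniteDimensional.trans F⟮X⟯ E L
    obtain ⟨a, ha, -⟩ := hρ.exists_ord_neg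
    refine hρ.torsion_eq L (Drinfeld.finite_torsion ρ.hom (fun a ha => ρ.hom_ne_zero ha) ha L
      (Module.finrank F⟮X⟯ L) fun u hu => ?_)
    change (minpoly F⟮X⟯ (algebraMap L Ω ⟨u, hu⟩)).natDegree ≤ _
    rw [minpoly.algebraMap_eq Subtype.val_injective]
    exact minpoly.natDegree_le _
  · intro Ω _ _ _ L _
    have : IsAlgClosed Ω := IsAlgClosure.isAlgClosed F⟮X⟯
    have : Algebra.IsAlgebraic F⟮X⟯ Ω := IsAlgClosure.isAlgebraic
    refine Drinfeld.exists_torsion_eq_carlitzTorsion F L (Drinfeld.finite_torsion (Drinfeld.carlitz F)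
      (fun a ha => Drinfeld.carlitz_ne_zero F ha) (a₀ := Polynomial.X)
      (by rw [Drinfeld.degree_carlitz_X]; exact one_pos) L
      (Module.finrank F⟮X⟯ L) fun u hu => ?_)
    change (minpoly F⟮X⟯ (algebraMap L Ω ⟨u, hu⟩)).natDegree ≤ _
    rw [minpoly.algebraMap_eq Subtype.val_injective]
    exact minpoly.natDegree_le _
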